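/- Let $1\le r\le p$ and $N\ge 2$ be integers and let $\Omega\subseteq\mathbb R^2$ be open. Consider the unknowns $x_\alpha$, $u_\alpha=u^{(0)}_\alpha,u^{(1)}_\alpha,\dots,u^{(2p)}_\alpha$ ($1\le\alpha\le N$) and $h_\alpha$ ($1\le\alpha\le N-1$), with $(x_\alpha,u_\alpha)\in\Omega$, collected in a vector $z$, and the approximate equations, with small parameter $\varepsilon\to0$, $$x_{\alpha+1}-x_\alpha-\varepsilon h_\alpha=o(\varepsilon^r),\qquad u^{(J)}_{\alpha+1}-u^{(J)}_\alpha-\sum_{k=1}^{r}\frac{\varepsilon^k}{k!}h_\alpha^k u^{(J+k)}_\alpha=o(\varepsilon^r)\qquad(1\le\alpha\le N-1,\ 0\le J\le p).\tag{1}$$ Let $z'=f(z,\varepsilon,a)+o(\varepsilon^r)$ be a smooth (local) approximate one-parameter group, that is, $f(z,\varepsilon,0)=z+o(\varepsilon^r)$ and $f(f(z,\varepsilon,a),\varepsilon,b)=f(z,\varepsilon,a+b)+o(\varepsilon^r)$, and let its infinitesimal operator be $X^{(\Delta)}=\sum_{k=0}^r\varepsilon^kX_k^{(\Delta)}+o(\varepsilon^r)$,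 that is, $\partial_a f(z,\varepsilon,a)|_{a=0}$ equals, up to $o(\varepsilon^r)$, the vector of coefficients of $\sum_{k=0}^r\varepsilon^kX_k^{(\Delta)}$, where $$X_k^{(\Delta)}=\sum_{\alpha=1}^{N}\Big[\xi_k(x_\alpha,u_\alpha)\,\partial_{x_\alpha}+\varphi_k(x_\alpha,u_\alpha)\,\partial_{u_\alpha}+\sum_{i=1}^{2p}\varphi^{(i)}_{k,\alpha}\,\partial_{u^{(i)}_\alpha}\Big]+\sum_{\alpha=1}^{N-1}\sigma_{k,\alpha}\,\partial_{h_\alpha}.$$ All coefficients are smooth. Here $\varphi^{(i)}_{k,\alpha}$ denotes a function $\varphi_k^{(i)}$, the same for all nodes and involving only $x,u,u^{(1)},\dots,u^{(\max(i,p))}$, evaluated at the variables of node $\alpha$ (in particular it may be a function of $x,u,\dots,u^{(i)}$, as in the usual prolongation), $\varphi_k^{(0)}=\varphi_k$, and $\sigma_{k,\alpha}$ is a function of $x_\alpha,u_\alpha,u^{(1)}_\alpha,\dots,u^{(2p)}_\alpha$ and $h_1,\dots,h_{N-1}$. Put $D=\partial_x+u^{(1)}\partial_u+u^{(2)}\partial_{u^{(1)}}+\cdots$.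 The system (1) is called invariant if, for every family $z=z(\varepsilon)$, smooth near $\varepsilon=0$, that satisfies (1), the family $f(z(\varepsilon),\varepsilon,a)$ satisfies (1) for every $a$ for which $f(z(0),0,a)$ is defined. Then (1) is invariant if and only if, identically in the variables, $$\sigma_{k,\alpha}=\sum_{l=1}^{k+1}\frac{h_\alpha^l}{l!}\,D^l\xi_{k+1-l}(x_\alpha,u_\alpha)\qquad(0\le k\le r-1,\ 1\le\alpha\le N-1)$$ and $$\varphi_k^{(J+1)}=D\varphi_k^{(J)}-u^{(J+1)}D\xi_k\qquad(0\le k\le r-1,\ J\ge0,\ J+k\le p+r-1).$$ -/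

import Mathlib

open scoped ContDiff Topology
open Asymptotics

namespace FDSymmetry

/-- The variables `(x, u⁽⁰⁾, u⁽¹⁾, …, u⁽²ᵖ⁾)` attached to one node of the grid, where `u⁽⁰⁾ = u`. -/
abbrev Jet (p : ℕ) : Type := ℝ × (Fin (2 * p + 1) → ℝ)

/-- The derivative variable `u⁽ʲ⁾` (meaningful for `j ≤ 2p`). -/
def Jet.u {p : ℕ} (w : Jet p) (j : ℕ) : ℝ :=
  if hj : j < 2 * p + 1 then w.2 ⟨j, hj⟩ else 0

/-- The pair `(x, u)`. -/
def Jet.base {p : ℕ} (w : Jet p) : ℝ × ℝ := (w.1, w.u 0)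

/-- All unknowns for `M + 1` nodes: the node variables `(x_α, u_α, u_α⁽¹⁾, …, u_α⁽²ᵖ⁾)`, and the
step sizes `h_α` of the `M` steps; step `α` joins the nodes `α.castSucc` and `α.succ`. -/
abbrev Grid (p M : ℕ) : Type := (Fin (M + 1) → Jet p) × (Fin M → ℝ)

/-- The grid configurations all of whose nodes have `(x_α, u_α) ∈ Ω`. -/
def gridDomain (p M : ℕ) (Ω : Set (ℝ × ℝ)) : Set (Grid p M) :=
  {z | ∀ α, (z.1 α).base ∈ Ω}

/-- The total derivative `D = ∂ₓ + u⁽¹⁾ ∂_u + u⁽²⁾ ∂_{u⁽¹⁾} + ⋯ + u⁽²ᵖ⁾ ∂_{u⁽²ᵖ⁻¹⁾}`, that is, the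
derivative in the direction `(1, u⁽¹⁾, …, u⁽²ᵖ⁾, 0)`. On functions that do not involve `u⁽²ᵖ⁾`
nothing is cut off. -/
noncomputable def totalDeriv {p : ℕ} (ψ : Jet p → ℝ) (w : Jet p) : ℝ :=
  fderiv ℝ ψ w ((1 : ℝ), fun i : Fin (2 * p + 1) => w.u ((i : ℕ) + 1))

/-- Over `Ω`, the function `ψ` involves only `x, u, u⁽¹⁾, …, u⁽ᵐ⁾`. -/
def HasOrderLE {p : ℕ} (Ω : Set (ℝ × ℝ)) (m : ℕ) (ψ : Jet p → ℝ) : Prop :=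
  ∀ w w' : Jet p, w.base ∈ Ω → w'.base ∈ Ω → w.1 = w'.1 → (∀ i, i ≤ m → w.u i = w'.u i) →
    ψ w = ψ w'

/-- The coefficients, for `0 ≤ k ≤ r`, of
`X_k = ∑_α [ξ_k ∂_{x_α} + φ_k⁽⁰⁾ ∂_{u_α} + ∑_{1 ≤ i ≤ 2p} φ_k⁽ⁱ⁾ ∂_{u_α⁽ⁱ⁾}] + ∑_α σ_{k,α} ∂_{h_α}`.
Here `ξ_k` and `φ_k⁽⁰⁾` are functions of `(x, u)` and `φ_k⁽ⁱ⁾` is a function of the node variables,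
all taken at node `α`; the coefficient `σ_{k,α}` may involve the variables of node `α` and the
step sizes. -/
structure Coefficients (p r M : ℕ) (Ω : Set (ℝ × ℝ)) where
  ξ : ℕ → ℝ × ℝ → ℝ
  φ : ℕ → ℕ → Jet p → ℝ
  σ : ℕ → Fin M → Jet p → (Fin M → ℝ) → ℝ
  ξ_smooth : ∀ k ≤ r, ContDiffOn ℝ ∞ (ξ k) Ω
  φ_smooth : ∀ k ≤ r, ∀ J ≤ 2 * p, ContDiffOn ℝ ∞ (φ k J) {w | w.base ∈ Ω}
  σ_smooth : ∀ k ≤ r, ∀ α, ContDiffOn ℝ ∞ (fun q : Jet p × (Fin M → ℝ) => σ k α q.1 q.2)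
    {q | q.1.base ∈ Ω}
  φ_zero_order : ∀ k ≤ r, HasOrderLE Ω 0 (φ k 0)
  φ_order : ∀ k ≤ r, ∀ J ≤ 2 * p, HasOrderLE Ω (max J p) (φ k J)

/-- The coefficient `ξ_k(x, u)` as a function of all variables of a node. -/
def Coefficients.ξJet {p r M : ℕ} {Ω : Set (ℝ × ℝ)} (X : Coefficients p r M Ω) (k : ℕ) :
    Jet p → ℝ :=
  fun w => X.ξ k w.base

/-- The vector field `X_k` on the space of all unknowns. -/
def Coefficients.field {p r M : ℕ} {Ω : Set (ℝ × ℝ)} (X : Coefficients p r M Ω) (k : ℕ)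
    (z : Grid p M) : Grid p M :=
  (fun α => (X.ξ k (z.1 α).base, fun J => X.φ k J (z.1 α)),
    fun α => X.σ k α (z.1 α.castSucc) z.2)

/-- A (local) approximate one-parameter group `z' = f(z, ε, a) + o(ε^r)` acting on the open set
`S`. The map `f` is smooth on an open domain `U` of triples `(z, ε, a)`, which contains all
`(z, 0, 0)` and whose `a`-slices at `ε = 0` are intervals. It is not required that only `a = 0`
acts as the identity. -/
structure IsApproxGroup {Z : Type*} [NormedAddCommGroup Z] [NormedSpace ℝ Z] (r : ℕ) (S : Set Z)
    (U : Set (Z × ℝ × ℝ)) (f : Z → ℝ → ℝ → Z) : Prop where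
  isOpen_domain : IsOpen U
  zero_mem : ∀ z ∈ S, (z, (0 : ℝ), (0 : ℝ)) ∈ U
  slice : ∀ z ∈ S, {a : ℝ | (z, (0 : ℝ), a) ∈ U}.OrdConnected
  mapsTo : ∀ z ε a, (z, ε, a) ∈ U → z ∈ S ∧ f z ε a ∈ S
  smooth : ContDiffOn ℝ ∞ (fun q : Z × ℝ × ℝ => f q.1 q.2.1 q.2.2) U
  initial : ∀ z ∈ S, (fun ε : ℝ => f z ε 0 - z) =o[𝓝 0] fun ε => ε ^ r
  group_law : ∀ z a b, (z, (0 : ℝ), a) ∈ U → (f z 0 a, (0 : ℝ), b) ∈ U →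
    (z, (0 : ℝ), a + b) ∈ U →
    (fun ε : ℝ => f (f z ε a) ε b - f z ε (a + b)) =o[𝓝 0] fun ε => ε ^ r

/-- The approximate infinitesimal operator of `f` is `∑_{k ≤ r} ε^k X_k + o(ε^r)`. -/
def HasApproxGenerator {Z : Type*} [NormedAddCommGroup Z] [NormedSpace ℝ Z] (r : ℕ) (S : Set Z)
    (f : Z → ℝ → ℝ → Z) (X : ℕ → Z → Z) : Prop :=
  ∀ z ∈ S, (fun ε : ℝ => deriv (fun a => f z ε a) 0 - ∑ k ∈ Finset.range (r + 1), ε ^ k • X k z)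
    =o[𝓝 0] fun ε => ε ^ r

/-- The system `F_i(z, ε) = o(ε^r)` is invariant under `f`: whenever `z = z(ε)`, smooth near
`ε = 0`, satisfies the system, so does `f(z(ε), ε, a)`, for every `a` for which it is defined. -/
def IsApproxInvariant {Z ι : Type*} [NormedAddCommGroup Z] [NormedSpace ℝ Z] (r : ℕ) (S : Set Z)
    (U : Set (Z × ℝ × ℝ)) (f : Z → ℝ → ℝ → Z) (F : ι → Z → ℝ → ℝ) : Prop :=
  ∀ z : ℝ → Z, ContDiffAt ℝ ∞ z 0 → z 0 ∈ S →
    (∀ i, (fun ε : ℝ => F i (z ε) ε) =o[𝓝 0] fun ε => ε ^ r) →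
    ∀ a : ℝ, (z 0, (0 : ℝ), a) ∈ U →
      ∀ i, (fun ε : ℝ => F i (f (z ε) ε a) ε) =o[𝓝 0] fun ε => ε ^ r

/-- The left-hand sides of the step-size relations `x_{α+1} - x_α - ε h_α = o(ε^r)` and of the
finite-difference-derivative relations
`u_{α+1}⁽ᴶ⁾ - u_α⁽ᴶ⁾ - ∑_{1 ≤ k ≤ r} (ε^k / k!) h_α^k u_α⁽ᴶ⁺ᵏ⁾ = o(ε^r)`, `0 ≤ J ≤ p`. -/
noncomputable def taylorSystem (p r M : ℕ) :
    Fin M ⊕ (Fin M × Fin (p + 1)) → Grid p M → ℝ → ℝ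
  | Sum.inl α, z, ε => (z.1 α.succ).1 - (z.1 α.castSucc).1 - ε * z.2 α
  | Sum.inr (α, J), z, ε =>
      (z.1 α.succ).u J - (z.1 α.castSucc).u J
        - ∑ k ∈ Finset.Icc 1 r,
            ε ^ k / (k.factorial : ℝ) * z.2 α ^ k * (z.1 α.castSucc).u (J + k)

end FDSymmetry

namespace FDSymmetry

open Filter Set

/-! ### Estimates `o(t ^ n)` and `O(t ^ (n + 1))` for smooth functions with parameters -/

section Flat

variable {T E F : Type*} [TopologicalSpace T] [NormedAddCommGroup E] [NormedSpace ℝ E]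
  [NormedAddCommGroup F] [NormedSpace ℝ F]

/-! Write `A(z, ε) = ∑ ε^m X_m(z)` and `F` for the left-hand sides of the system. Invariance amounts
to tangency: the derivative of `F` along `A` must be `o(ε^r)` on solutions. Necessity follows by
differentiating the invariance in `a` at `a = 0`. For sufficiency, the differentiated group law
gives `∂ₐ f = A(f, ε) + O(ε^(r+1))` along orbits. Hence the error `e(a, ε) = F(f(z(ε), ε, a), ε)`
obeys `|∂ₐ e| ≤ K (|e| + |ε|^(r+1))`, and Gronwall's inequality with a connectedness argument
carries `e = O(ε^(r+1))` from `a = 0` over the whole interval of admissible `a`. All hypotheses are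
pointwise in `z` and `a`; they become uniform, and differentiable in the parameter, by
`isBigO_of_eventually_isLittleO` and `isLittleO_fderiv_fst`.

The model solutions are grids whose consecutive nodes are joined by the polynomial flow of `D` for
time `ε h_α`. There the derivative of `F_i` along `A` is `defect`, a function of one node `w`, of
`h` and of `ε`. On other grids the next node differs from the exact step by `F` up to `O(ε^(r+1))`
in the coordinates `x, u, …, u⁽ᵖ⁾`, and the coefficients differenced between nodes see only these
coordinates (`isBigO_sub_flow`). So invariance holds if and only if `defect = o(ε^r)` for all `w`
and `h`.

Taylor's formula along the flow turns this into the vanishing of the coefficients of `ε, …, ε^r`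
(`isLittleO_defect_iff`). The equations for `x` give the formula for `σ`. Substituted into the
equations for `u⁽ᴶ⁾`, it produces exactly the Leibniz terms by which `D^k φ⁽ᴶ⁾` differs from
`φ⁽ᴶ⁺ᵏ⁾` in a prolongation (`sum_leibnizSum`). What remains is a polynomial in `h` with coefficients
independent of `h`, so each coefficient vanishes, and this is equivalent to the one-step recursion
(`forall_sum_eq_zero_iff`). -/

theorem isBigOWith_of_hasDerivAt_snd {H H' : T × ℝ → F} {q : T} {n : ℕ} {c : ℝ} (hc : 0 ≤ c)
    (hd : ∀ᶠ s in 𝓝 (q, (0 : ℝ)), HasDerivAt (fun t => H (s.1, t)) (H' s) s.2)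
    (h0 : ∀ᶠ s in 𝓝 q, H (s, 0) = 0)
    (hO : IsBigOWith c (𝓝 (q, (0 : ℝ))) H' fun s => s.2 ^ n) :
    IsBigOWith c (𝓝 (q, (0 : ℝ))) H fun s => s.2 ^ (n + 1) := by
  have hall := hd.and hO.bound
  rw [nhds_prod_eq] at hall
  obtain ⟨A, hA, B, hB, hAB⟩ := eventually_prod_iff.1 hall
  obtain ⟨δ, hδ, hball⟩ := Metric.eventually_nhds_iff.1 hB
  rw [isBigOWith_iff, nhds_prod_eq]
  refine eventually_prod_iff.2 ⟨_, hA.and h0, _, Metric.ball_mem_nhds (0 : ℝ) hδ, ?_⟩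
  rintro s ⟨hsA, hs0⟩ t ht
  have ht' : |t| < δ := by
    have : t ∈ Metric.ball (0 : ℝ) δ := ht
    simpa using this
  have hIcc : ∀ y ∈ Icc (-|t|) |t|, HasDerivAt (fun t => H (s, t)) (H' (s, y)) y ∧
      ‖H' (s, y)‖ ≤ c * |t| ^ n := by
    intro y hy
    have hy' : |y| ≤ |t| := abs_le.2 hy
    have := hAB hsA (hball (y := y) (by simpa using hy'.trans_lt ht'))
    refine ⟨this.1, this.2.trans ?_⟩
    simp only [norm_pow, Real.norm_eq_abs]
    gcongr
  -- Mean value inequality between `0` and `t`; the symmetric interval treats both signs of `t` at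
  -- once.
  have := (convex_Icc (-|t|) |t|).norm_image_sub_le_of_norm_hasDerivWithin_le
    (f := fun t => H (s, t)) (fun y hy => (hIcc y hy).1.hasDerivWithinAt)
    (fun y hy => (hIcc y hy).2) (x := 0) (y := t) (by simp)
    (by simp [neg_abs_le, le_abs_self])
  simp only [hs0, sub_zero, Real.norm_eq_abs] at this
  rwa [Real.norm_eq_abs, abs_pow, pow_succ, ← mul_assoc]

theorem isBigO_of_hasDerivAt_snd {H H' : T × ℝ → F} {q : T} {n : ℕ}
    (hd : ∀ᶠ s in 𝓝 (q, (0 : ℝ)), HasDerivAt (fun t => H (s.1, t)) (H' s) s.2)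
    (h0 : ∀ᶠ s in 𝓝 q, H (s, 0) = 0) (hO : H' =O[𝓝 (q, (0 : ℝ))] fun s => s.2 ^ n) :
    H =O[𝓝 (q, (0 : ℝ))] fun s => s.2 ^ (n + 1) := by
  obtain ⟨c, hc, h⟩ := hO.exists_nonneg
  exact (isBigOWith_of_hasDerivAt_snd hc hd h0 h).isBigO

/-- Integration in `t` preserves the constant of the estimate, so the parametric bound also serves
for little-o: take a one-point parameter space and every `c > 0`. -/
theorem isLittleO_of_hasDerivAt {g g' : ℝ → F} {n : ℕ}
    (hd : ∀ᶠ t in 𝓝 (0 : ℝ), HasDerivAt g (g' t) t) (h0 : g 0 = 0)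
    (ho : g' =o[𝓝 0] fun t => t ^ n) : g =o[𝓝 0] fun t => t ^ (n + 1) := by
  have hsnd : Tendsto (Prod.snd : Unit × ℝ → ℝ) (𝓝 ((), 0)) (𝓝 0) := continuous_snd.tendsto' _ _ rfl
  have hmk : Tendsto (fun t : ℝ => ((), t)) (𝓝 0) (𝓝 ((), 0)) :=
    (Continuous.prodMk_right ()).tendsto' _ _ rfl
  refine IsLittleO.of_isBigOWith fun c hc => ?_
  exact (isBigOWith_of_hasDerivAt_snd (H := fun s : Unit × ℝ => g s.2) (H' := fun s => g' s.2)
    (q := ()) hc.le (hsnd.eventually hd) (.of_forall fun _ => h0)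
    ((ho.forall_isBigOWith hc).comp_tendsto hsnd)).comp_tendsto hmk

/-- Induction on `n`, integrating the expansion of the derivative term by term. The coefficients
stay implicit, since only the existence of an expansion is used. -/
theorem exists_taylor_isLittleO (n : ℕ) {g : ℝ → F} (hg : ContDiffAt ℝ n g 0) :
    ∃ c : ℕ → F, (fun t => g t - ∑ i ∈ Finset.range (n + 1), t ^ i • c i) =o[𝓝 0]
      fun t => t ^ n := by
  induction n generalizing g with
  | zero =>
    refine ⟨fun _ => g 0, ?_⟩
    have := hg.continuousAt.tendsto.sub_const (g 0)
    simpa [isLittleO_one_iff] using this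
  | succ n ih =>
    have hev : ∀ᶠ t in 𝓝 (0 : ℝ), ContDiffAt ℝ ((n + 1 : ℕ)) g t := hg.eventually (by simp)
    have hd : ContDiffAt ℝ n (deriv g) 0 := by
      have := (hg.fderiv_right (m := n) (by simp)).clm_apply
        (contDiffAt_const (c := (1 : ℝ)))
      simpa only [fderiv_apply_one_eq_deriv] using this
    obtain ⟨c, hc⟩ := ih hd
    refine ⟨fun i => i.casesOn (g 0) fun j => ((j : ℝ) + 1)⁻¹ • c j, ?_⟩
    refine isLittleO_of_hasDerivAt (hev.mono fun t ht => ?_) ?_ hc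
    · have h1 := (ht.differentiableAt (by simp)).hasDerivAt
      refine h1.sub ?_
      simp only [Finset.sum_range_succ' _ (n + 1)]
      have : ∀ i ∈ Finset.range (n + 1),
          HasDerivAt (fun t : ℝ => t ^ (i + 1) • (((i : ℝ) + 1)⁻¹ • c i)) (t ^ i • c i) t := by
        intro i _
        have := (hasDerivAt_pow (i + 1) t).smul_const (((i : ℝ) + 1)⁻¹ • c i)
        refine this.congr_deriv ?_
        rw [smul_smul]
        congr 1
        have : (i : ℝ) + 1 ≠ 0 := by positivity
        rw [Nat.cast_succ, Nat.add_sub_cancel]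
        field_simp
      simpa using (HasDerivAt.fun_sum this).add_const (g 0)
    · simp [Finset.sum_range_succ']

/-- Once the coefficients below `i` are known to vanish, divide by `t ^ i` and let `t → 0` through
nonzero values. -/
theorem coeff_eq_zero_of_isLittleO {n : ℕ} {c : ℕ → F}
    (h : (fun t : ℝ => ∑ i ∈ Finset.range (n + 1), t ^ i • c i) =o[𝓝 0] fun t => t ^ n) :
    ∀ i ≤ n, c i = 0 := by
  intro i
  induction i using Nat.strong_induction_on with
  | _ i ih =>
    intro hi
    have h1 : (fun t : ℝ => ∑ i ∈ Finset.range (n + 1), t ^ i • c i) =o[𝓝[≠] 0] fun t => t ^ i :=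
      (h.trans_isBigO (IsBigO.of_bound 1 (by
        filter_upwards [Metric.ball_mem_nhds (0 : ℝ) one_pos] with t ht
        have : |t| < 1 := by simpa using ht
        simpa using pow_le_pow_of_le_one (abs_nonneg t) this.le hi))).mono nhdsWithin_le_nhds
    have h2 : Tendsto (fun t : ℝ => (t ^ i)⁻¹ • ∑ j ∈ Finset.range (n + 1), t ^ j • c j)
        (𝓝[≠] 0) (𝓝 0) := by
      have := (isLittleO_iff_tendsto' (f := fun t : ℝ =>
        ‖∑ i ∈ Finset.range (n + 1), t ^ i • c i‖) (g := fun t => |t| ^ i) (l := 𝓝[≠] (0 : ℝ)) (by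
          filter_upwards [self_mem_nhdsWithin] with t ht h0
          exact absurd h0 (pow_ne_zero _ (abs_ne_zero.2 ht)))).1 (by simpa using h1.norm_norm)
      rw [tendsto_zero_iff_norm_tendsto_zero]
      refine this.congr fun t => ?_
      rw [norm_smul, norm_inv, norm_pow, Real.norm_eq_abs, div_eq_inv_mul]
    have h3 : Tendsto (fun t : ℝ => ∑ j ∈ Finset.range (n + 1 - i), t ^ j • c (i + j))
        (𝓝[≠] 0) (𝓝 (c i)) := by
      have : Continuous fun t : ℝ => ∑ j ∈ Finset.range (n + 1 - i), t ^ j • c (i + j) := by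
        fun_prop
      refine (this.tendsto' 0 (c i) ?_).mono_left nhdsWithin_le_nhds
      rw [Nat.sub_add_comm hi, Finset.sum_range_succ']
      simp
    refine tendsto_nhds_unique (h3.congr' ?_) h2
    filter_upwards [self_mem_nhdsWithin] with t ht
    have ht : t ≠ 0 := ht
    obtain ⟨m, hm⟩ := Nat.exists_eq_add_of_le (show i ≤ n + 1 by omega)
    rw [hm, Nat.add_sub_cancel_left, Finset.sum_range_add,
      Finset.sum_eq_zero (s := Finset.range i) fun j hj => by
        rw [ih j (Finset.mem_range.1 hj) (by have := Finset.mem_range.1 hj; omega), smul_zero],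
      zero_add, Finset.smul_sum]
    refine Finset.sum_congr rfl fun j _ => ?_
    rw [smul_smul, pow_add, inv_mul_cancel_left₀ (pow_ne_zero _ ht)]

omit [NormedSpace ℝ F] in
theorem eq_zero_of_isLittleO_pow {g : ℝ → F} {n : ℕ} (hg : ContinuousAt g 0)
    (h : g =o[𝓝 0] fun t => t ^ n) : g 0 = 0 := by
  have h1 : g =o[𝓝 0] fun _ => (1 : ℝ) := h.trans_isBigO (by
    have : ContinuousAt (fun t : ℝ => t ^ n) 0 := by fun_prop
    exact this.tendsto.isBigO_one ℝ)
  exact tendsto_nhds_unique hg.tendsto ((isLittleO_one_iff ℝ).1 h1)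

/-- A little-o relation cannot be differentiated in general. Here `g'` has a Taylor polynomial of
degree `n`, and its primitive is `o(t ^ (n + 1))` together with `g`. Hence all its coefficients are
zero. -/
theorem isLittleO_deriv {g : ℝ → F} {n : ℕ} (hg : ContDiffAt ℝ ((n + 1 : ℕ)) g 0)
    (ho : g =o[𝓝 0] fun t => t ^ (n + 1)) : deriv g =o[𝓝 0] fun t => t ^ n := by
  have hev : ∀ᶠ t in 𝓝 (0 : ℝ), ContDiffAt ℝ ((n + 1 : ℕ)) g t := hg.eventually (by simp)
  have hd : ContDiffAt ℝ n (deriv g) 0 := by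
    have := (hg.fderiv_right (m := n) (by simp)).clm_apply
      (contDiffAt_const (c := (1 : ℝ)))
    simpa only [fderiv_apply_one_eq_deriv] using this
  obtain ⟨c, hc⟩ := exists_taylor_isLittleO n hd
  have hg0 : g 0 = 0 := eq_zero_of_isLittleO_pow hg.continuousAt ho
  have hT : (fun t => g t - ∑ i ∈ Finset.range (n + 1), t ^ (i + 1) • (((i : ℝ) + 1)⁻¹ • c i))
      =o[𝓝 0] fun t => t ^ (n + 1) := by
    refine isLittleO_of_hasDerivAt (hev.mono fun t ht => ?_) ?_ hc
    · have h1 := (ht.differentiableAt (by simp)).hasDerivAt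
      refine h1.sub ?_
      refine HasDerivAt.fun_sum fun i _ => ?_
      have := (hasDerivAt_pow (i + 1) t).smul_const (((i : ℝ) + 1)⁻¹ • c i)
      refine this.congr_deriv ?_
      rw [smul_smul]
      congr 1
      have : (i : ℝ) + 1 ≠ 0 := by positivity
      rw [Nat.cast_succ, Nat.add_sub_cancel]
      field_simp
    · simp [hg0]
  have hP := ho.sub hT
  simp only [sub_sub_cancel] at hP
  -- Coefficients of the integrated polynomial: the index moves up by one and the constant term is
  -- zero.
  let d : ℕ → F := fun i => i.casesOn 0 fun j => ((j : ℝ) + 1)⁻¹ • c j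
  have := coeff_eq_zero_of_isLittleO (n := n + 1) (c := d) (by
    simpa [Finset.sum_range_succ' _ (n + 1), d] using hP)
  have hc0 : ∀ i ∈ Finset.range (n + 1), c i = 0 := by
    intro i hi
    have h1 := this (i + 1) (by have := Finset.mem_range.1 hi; omega)
    have h2 : (i : ℝ) + 1 ≠ 0 := by positivity
    simpa [h2, d] using h1
  refine hc.congr_left fun t => ?_
  rw [Finset.sum_eq_zero fun i hi => by rw [hc0 i hi, smul_zero], sub_zero]

theorem contDiffAt_fderiv_apply_const {H : E → F} {q : E} {n : ℕ}
    (hH : ContDiffAt ℝ ((n + 1 : ℕ)) H q) (v : E) :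
    ContDiffAt ℝ n (fun s => fderiv ℝ H s v) q :=
  (hH.fderiv_right (m := n) (by simp)).clm_apply contDiffAt_const

theorem hasDerivAt_snd {H : E × ℝ → F} {s : E × ℝ} (hH : DifferentiableAt ℝ H s) :
    HasDerivAt (fun t => H (s.1, t)) (fderiv ℝ H s (0, 1)) s.2 := by
  have h1 : HasDerivAt (fun t : ℝ => (s.1, t)) ((0 : E), (1 : ℝ)) s.2 :=
    (hasDerivAt_const _ _).prodMk (hasDerivAt_id _)
  exact HasFDerivAt.comp_hasDerivAt (f := fun t : ℝ => (s.1, t)) s.2 hH.hasFDerivAt h1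

theorem eventually_isLittleO_fderiv_snd {H : E × ℝ → F} {q : E} {n : ℕ}
    (hH : ContDiffAt ℝ ((n + 1 : ℕ)) H (q, 0))
    (h : ∀ᶠ s in 𝓝 q, (fun t => H (s, t)) =o[𝓝 0] fun t => t ^ (n + 1)) :
    ∀ᶠ s in 𝓝 q, (fun t => fderiv ℝ H (s, t) (0, 1)) =o[𝓝 0] fun t => t ^ n := by
  have hmk : Tendsto (fun s : E => (s, (0 : ℝ))) (𝓝 q) (𝓝 (q, 0)) :=
    (Continuous.prodMk_left (0 : ℝ)).tendsto' _ _ rfl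
  filter_upwards [h, hmk.eventually (hH.eventually (by simp))] with s hs hsm
  have hs1 : ContDiffAt ℝ ((n + 1 : ℕ)) (fun t => H (s, t)) 0 :=
    ContDiffAt.comp (0 : ℝ) (f := fun t : ℝ => (s, t)) hsm (by fun_prop)
  refine (isLittleO_deriv hs1 hs).congr' ?_ .rfl
  have hmk' : Tendsto (fun t : ℝ => (s, t)) (𝓝 0) (𝓝 (s, 0)) :=
    (Continuous.prodMk_right s).tendsto' _ _ rfl
  filter_upwards [hmk'.eventually (hsm.eventually (by simp))] with t ht
  exact (hasDerivAt_snd (ht.differentiableAt (by simp))).deriv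

theorem eventually_eq_zero_of_isLittleO_pow {H : E × ℝ → F} {q : E} {n k : ℕ}
    (hH : ContDiffAt ℝ k H (q, 0))
    (h : ∀ᶠ s in 𝓝 q, (fun t => H (s, t)) =o[𝓝 0] fun t => t ^ n) :
    ∀ᶠ s in 𝓝 q, H (s, 0) = 0 := by
  have hmk : Tendsto (fun s : E => (s, (0 : ℝ))) (𝓝 q) (𝓝 (q, 0)) :=
    (Continuous.prodMk_left (0 : ℝ)).tendsto' _ _ rfl
  filter_upwards [h, hmk.eventually (hH.eventually (by simp))] with s hs hsm
  refine eq_zero_of_isLittleO_pow ?_ hs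
  exact ContinuousAt.comp (f := fun t : ℝ => (s, t)) hsm.continuousAt (by fun_prop)

/-- A smooth function which is `o(t ^ n)` for each value of the parameter is `O(t ^ (n + 1))`
locally uniformly in the parameter. -/
theorem isBigO_of_eventually_isLittleO {H : E × ℝ → F} {q : E} {n : ℕ}
    (hH : ContDiffAt ℝ ((n + 1 : ℕ)) H (q, 0))
    (h : ∀ᶠ s in 𝓝 q, (fun t => H (s, t)) =o[𝓝 0] fun t => t ^ n) :
    H =O[𝓝 (q, (0 : ℝ))] fun s => s.2 ^ (n + 1) := by
  induction n generalizing H with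
  | zero =>
    refine isBigO_of_hasDerivAt_snd ((hH.eventually (by simp)).mono fun s hs =>
      hasDerivAt_snd (hs.differentiableAt (by simp)))
      (eventually_eq_zero_of_isLittleO_pow hH h) ?_
    simpa using (contDiffAt_fderiv_apply_const hH (0, 1)).continuousAt.tendsto.isBigO_one ℝ
  | succ n ih =>
    exact isBigO_of_hasDerivAt_snd ((hH.eventually (by simp)).mono fun s hs =>
      hasDerivAt_snd (hs.differentiableAt (by simp)))
      (eventually_eq_zero_of_isLittleO_pow hH h)
      (ih (contDiffAt_fderiv_apply_const hH (0, 1)) (eventually_isLittleO_fderiv_snd (hH.of_le (by simp)) h))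

theorem fderiv_fst_eq_zero {H : E × ℝ → F} {q : E} (hH : DifferentiableAt ℝ H (q, 0))
    (h0 : ∀ᶠ s in 𝓝 q, H (s, 0) = 0) (v : E) : fderiv ℝ H (q, 0) (v, 0) = 0 := by
  have h2 := HasFDerivAt.comp (f := fun s : E => (s, (0 : ℝ))) q hH.hasFDerivAt
    (hasFDerivAt_prodMk_left q (0 : ℝ))
  have h3 : HasFDerivAt (H ∘ fun s : E => (s, (0 : ℝ))) (0 : E →L[ℝ] F) q :=
    (hasFDerivAt_const (0 : F) q).congr_of_eventuallyEq h0
  simpa using congrArg (fun L : E →L[ℝ] F => L v) (h2.unique h3)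

/-- A relation `H(q, t) = o(t ^ n)` may be differentiated with respect to the parameter. -/
theorem isLittleO_fderiv_fst {H : E × ℝ → F} {q : E} {n : ℕ}
    (hH : ContDiffAt ℝ ((n + 2 : ℕ)) H (q, 0))
    (h : ∀ᶠ s in 𝓝 q, (fun t => H (s, t)) =o[𝓝 0] fun t => t ^ n) (v : E) :
    (fun t => fderiv ℝ H (q, t) (v, 0)) =o[𝓝 0] fun t => t ^ n := by
  have hzero : fderiv ℝ H (q, 0) (v, 0) = 0 :=
    fderiv_fst_eq_zero (hH.differentiableAt (by simp)) (eventually_eq_zero_of_isLittleO_pow hH h) v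
  have hmk : Tendsto (fun t : ℝ => (q, t)) (𝓝 0) (𝓝 (q, 0)) :=
    (Continuous.prodMk_right q).tendsto' _ _ rfl
  induction n generalizing H with
  | zero =>
    have hc : ContinuousAt (fun t => fderiv ℝ H (q, t) (v, 0)) 0 :=
      ContinuousAt.comp (f := fun t : ℝ => (q, t))
        (contDiffAt_fderiv_apply_const (n := 1) hH (v, 0)).continuousAt (by fun_prop)
    simpa [isLittleO_one_iff, ContinuousAt, hzero] using hc
  | succ n ih =>
    have hH' : ContDiffAt ℝ ((n + 2 : ℕ)) (fun s => fderiv ℝ H s (0, 1)) (q, 0) :=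
      contDiffAt_fderiv_apply_const hH (0, 1)
    have h' := eventually_isLittleO_fderiv_snd (n := n) (hH.of_le (by norm_cast; omega)) h
    have hz' : fderiv ℝ (fun s => fderiv ℝ H s (0, 1)) (q, 0) (v, 0) = 0 :=
      fderiv_fst_eq_zero (hH'.differentiableAt (by simp))
        (eventually_eq_zero_of_isLittleO_pow hH' h') v
    -- Induction goes through `∂_t H`: its parameter derivative is `o(t ^ n)`, equals the
    -- `t`-derivative of the parameter derivative of `H` by symmetry of second derivatives, and is
    -- then integrated from the value zero at `t = 0`.
    refine isLittleO_of_hasDerivAt ?_ hzero (ih hH' h' hz')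
    filter_upwards [hmk.eventually (hH.eventually (by simp [-Nat.cast_add]))] with t ht
    have hd2 : DifferentiableAt ℝ (fderiv ℝ H) (q, t) :=
      (ht.fderiv_right (m := 1) (by norm_cast; omega)).differentiableAt (by simp)
    have h1 := hasDerivAt_snd (H := fun s => fderiv ℝ H s (v, 0)) (s := (q, t))
      (hd2.clm_apply (differentiableAt_const _))
    refine h1.congr_deriv ?_
    have hsymm : IsSymmSndFDerivAt ℝ H (q, t) := ht.isSymmSndFDerivAt (by
      simp only [minSmoothness_of_isRCLikeNormedField]; norm_cast; omega)
    have key : ∀ a b : E × ℝ, fderiv ℝ (fun s => fderiv ℝ H s a) (q, t) b =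
        fderiv ℝ (fderiv ℝ H) (q, t) b a := by
      intro a b
      rw [fderiv_clm_apply hd2 (differentiableAt_const _)]
      simp
    rw [key, key, hsymm.eq]

end Flat

/-! ### Gronwall's inequality for approximate solutions -/

section Gronwall

variable {V : Type*} [NormedAddCommGroup V] [NormedSpace ℝ V]

theorem norm_le_gronwallBound_of_le {f f' : ℝ → V} {D K η a b : ℝ} (hab : a ≤ b)
    (hd : ∀ x ∈ Icc a b, HasDerivAt f (f' x) x) (ha : ‖f a‖ ≤ D)
    (hK : ∀ x ∈ Icc a b, ‖f' x‖ ≤ K * ‖f x‖ + η) :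
    ‖f b‖ ≤ gronwallBound D K η (b - a) :=
  norm_le_gronwallBound_of_norm_deriv_right_le (f := f) (f' := f')
    (fun x hx => (hd x hx).continuousAt.continuousWithinAt)
    (fun x hx => (hd x (Ico_subset_Icc_self hx)).hasDerivWithinAt) ha
    (fun x hx => hK x (Ico_subset_Icc_self hx)) b ⟨hab, le_rfl⟩

theorem norm_le_gronwallBound_of_uIcc {f f' : ℝ → V} {D K η a b : ℝ}
    (hd : ∀ x ∈ uIcc a b, HasDerivAt f (f' x) x) (ha : ‖f a‖ ≤ D)
    (hK : ∀ x ∈ uIcc a b, ‖f' x‖ ≤ K * ‖f x‖ + η) :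
    ‖f b‖ ≤ gronwallBound D K η |b - a| := by
  rcases le_total a b with hab | hab
  · rw [uIcc_of_le hab] at hd hK
    rw [abs_of_nonneg (sub_nonneg.2 hab)]
    exact norm_le_gronwallBound_of_le hab hd ha hK
  · rw [uIcc_of_ge hab] at hd hK
    rw [abs_of_nonpos (sub_nonpos.2 hab)]
    have hmem : ∀ x ∈ Icc (-a) (-b), -x ∈ Icc b a := fun x hx =>
      ⟨by linarith [hx.2], by linarith [hx.1]⟩
    have := norm_le_gronwallBound_of_le (f := fun x => f (-x)) (f' := fun x => -f' (-x))
      (D := D) (K := K) (η := η) (neg_le_neg hab)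
      (fun x hx => by
        have := (hd (-x) (hmem x hx)).scomp x (hasDerivAt_neg x)
        simpa [Function.comp_def] using this)
      (by simpa using ha) (fun x hx => by simpa using hK (-x) (hmem x hx))
    simpa [sub_eq_add_neg, add_comm] using this

/-- If `∂ₐ e = O(‖e‖ + |t| ^ n)` near `(a₀, 0)`, then the estimate `e(a, t) = O(t ^ n)` propagates
between any two values of `a` near `a₀`. -/
theorem exists_nhds_isBigO_propagates {e e' : ℝ × ℝ → V} {a₀ : ℝ} {n : ℕ}
    (hd : ∀ᶠ s in 𝓝 (a₀, (0 : ℝ)), HasDerivAt (fun a => e (a, s.2)) (e' s) s.1)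
    (hO : e' =O[𝓝 (a₀, (0 : ℝ))] fun s => ‖e s‖ + |s.2| ^ n) :
    ∃ A ∈ 𝓝 a₀, ∀ a ∈ A, ∀ b ∈ A, (fun t => e (a, t)) =O[𝓝 0] (fun t : ℝ => t ^ n) →
      (fun t => e (b, t)) =O[𝓝 0] fun t : ℝ => t ^ n := by
  obtain ⟨K, hK, hKO⟩ := hO.exists_pos
  have hall := hd.and hKO.bound
  rw [nhds_prod_eq] at hall
  obtain ⟨A, hA, B, hB, hAB⟩ := eventually_prod_iff.1 hall
  obtain ⟨δ, hδ, hball⟩ := Metric.eventually_nhds_iff.1 hA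
  refine ⟨Metric.ball a₀ δ, Metric.ball_mem_nhds _ hδ, fun a ha b hb hab => ?_⟩
  obtain ⟨C, hC⟩ := hab.bound
  have hsub : uIcc a b ⊆ Metric.ball a₀ δ := by
    rw [← segment_eq_uIcc]
    exact (convex_ball a₀ δ).segment_subset ha hb
  -- This is the Gronwall bound with initial value `C |t|^n`, rate `K` and inhomogeneity `K |t|^n`,
  -- divided by `|t|^n`.
  refine IsBigO.of_bound (C * Real.exp (K * |b - a|) + (Real.exp (K * |b - a|) - 1)) ?_
  filter_upwards [hC, hB] with t htC htB
  have := norm_le_gronwallBound_of_uIcc (f := fun a => e (a, t)) (f' := fun a => e' (a, t))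
    (K := K) (η := K * |t| ^ n) (fun x hx => (hAB (hball (hsub hx)) htB).1) htC
    (fun x hx => by
      have := (hAB (hball (hsub hx)) htB).2
      rw [Real.norm_of_nonneg (by positivity)] at this
      linarith)
  refine this.trans (le_of_eq ?_)
  rw [gronwallBound_of_K_ne_0 hK.ne']
  simp only [norm_pow, Real.norm_eq_abs]
  field_simp

end Gronwall

/-! ### The flow of the total derivative and Taylor's formula along it -/

section Flow

variable {p : ℕ}

theorem Jet.u_of_lt {w : Jet p} {j : ℕ} (hj : j < 2 * p + 1) : w.u j = w.2 ⟨j, hj⟩ := dif_pos hj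

theorem Jet.u_of_le {w : Jet p} {j : ℕ} (hj : 2 * p + 1 ≤ j) : w.u j = 0 := dif_neg (by omega)

theorem Jet.ext_u {w v : Jet p} (h1 : w.1 = v.1) (h2 : ∀ j, j ≤ 2 * p → w.u j = v.u j) :
    w = v := by
  refine Prod.ext h1 (funext fun i => ?_)
  have := h2 i (by omega)
  rwa [Jet.u_of_lt i.2, Jet.u_of_lt i.2] at this

theorem Jet.contDiff_u {n : ℕ∞ω} (j : ℕ) : ContDiff ℝ n (fun w : Jet p => w.u j) := by
  unfold Jet.u
  split_ifs <;> fun_prop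

@[fun_prop]
theorem Jet.contDiffAt_u_comp {E : Type*} [NormedAddCommGroup E] [NormedSpace ℝ E] {n : ℕ∞ω}
    {g : E → Jet p} {q : E} (hg : ContDiffAt ℝ n g q) (j : ℕ) :
    ContDiffAt ℝ n (fun s => (g s).u j) q :=
  (Jet.contDiff_u j).contDiffAt.comp q hg

@[fun_prop]
theorem Jet.contDiff_u_comp {E : Type*} [NormedAddCommGroup E] [NormedSpace ℝ E] {n : ℕ∞ω}
    {g : E → Jet p} (hg : ContDiff ℝ n g) (j : ℕ) : ContDiff ℝ n (fun s => (g s).u j) :=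
  (Jet.contDiff_u j).comp hg

theorem Jet.contDiff_base {n : ℕ∞ω} : ContDiff ℝ n (Jet.base : Jet p → ℝ × ℝ) := by
  unfold Jet.base
  fun_prop

/-- The flow of the vector field `∂ₓ + u⁽¹⁾ ∂_u + ⋯ + u⁽²ᵖ⁾ ∂_{u⁽²ᵖ⁻¹⁾}`. -/
noncomputable def flow (w : Jet p) (t : ℝ) : Jet p :=
  (w.1 + t, fun J => ∑ j ∈ Finset.range (2 * p + 1), t ^ j / (j.factorial : ℝ) * w.u (J + j))

theorem flow_u (w : Jet p) (t : ℝ) (J : ℕ) :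
    (flow w t).u J = ∑ j ∈ Finset.range (2 * p + 1), t ^ j / (j.factorial : ℝ) * w.u (J + j) := by
  rcases lt_or_ge J (2 * p + 1) with hJ | hJ
  · rw [Jet.u_of_lt hJ]
    rfl
  · rw [Jet.u_of_le hJ, Finset.sum_eq_zero]
    intro j _
    rw [Jet.u_of_le (by omega), mul_zero]

@[simp]
theorem flow_fst (w : Jet p) (t : ℝ) : (flow w t).1 = w.1 + t := rfl

theorem flow_zero (w : Jet p) : flow w 0 = w := by
  refine Jet.ext_u (by simp) fun j _ => ?_
  rw [flow_u, Finset.sum_range_succ']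
  simp

theorem contDiff_flow {n : ℕ∞ω} : ContDiff ℝ n (fun q : Jet p × ℝ => flow q.1 q.2) := by
  unfold flow
  refine ContDiff.prodMk (by fun_prop) (contDiff_pi.2 fun J => ?_)
  refine ContDiff.sum fun j _ => ?_
  simp only [div_eq_mul_inv]
  fun_prop

@[fun_prop]
theorem contDiffAt_flow_comp {E : Type*} [NormedAddCommGroup E] [NormedSpace ℝ E] {n : ℕ∞ω}
    {g : E → Jet p} {s : E → ℝ} {q : E} (hg : ContDiffAt ℝ n g q) (hs : ContDiffAt ℝ n s q) :
    ContDiffAt ℝ n (fun y => flow (g y) (s y)) q :=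
  contDiff_flow.contDiffAt.comp q (hg.prodMk hs)

@[fun_prop]
theorem contDiff_flow_comp {E : Type*} [NormedAddCommGroup E] [NormedSpace ℝ E] {n : ℕ∞ω}
    {g : E → Jet p} {s : E → ℝ} (hg : ContDiff ℝ n g) (hs : ContDiff ℝ n s) :
    ContDiff ℝ n (fun y => flow (g y) (s y)) :=
  contDiff_flow.comp (hg.prodMk hs)

theorem hasDerivAt_flow_u (w : Jet p) (t : ℝ) (J : ℕ) :
    HasDerivAt (fun t => (flow w t).u J) ((flow w t).u (J + 1)) t := by
  simp only [flow_u]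
  have h : ∀ j ∈ Finset.range (2 * p), HasDerivAt
      (fun t : ℝ => t ^ (j + 1) / ((j + 1).factorial : ℝ) * w.u (J + (j + 1)))
      (t ^ j / (j.factorial : ℝ) * w.u (J + 1 + j)) t := by
    intro j _
    refine (((hasDerivAt_pow (j + 1) t).div_const _).mul_const _).congr_deriv ?_
    rw [Nat.add_sub_cancel, Nat.factorial_succ, add_assoc J 1 j, add_comm 1 j]
    have : ((j : ℝ) + 1) ≠ 0 := by positivity
    push_cast
    field_simp
  have h2 := (HasDerivAt.fun_sum h).add_const (t ^ 0 / ((0 : ℕ).factorial : ℝ) * w.u (J + 0))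
  -- Differentiation leaves one term fewer than the sum for `u⁽ᴶ⁺¹⁾` has; the missing top term lies
  -- beyond the cut-off `2p`.
  have h3 : w.u (J + 1 + 2 * p) = 0 := Jet.u_of_le (by omega)
  rw [Finset.sum_range_succ, h3, mul_zero, add_zero]
  refine h2.congr_of_eventuallyEq (.of_forall fun s => ?_)
  simp only [pow_zero]
  rw [Finset.sum_range_succ', pow_zero]

theorem hasDerivAt_flow (w : Jet p) (t : ℝ) :
    HasDerivAt (flow w) ((1 : ℝ), fun i : Fin (2 * p + 1) => (flow w t).u ((i : ℕ) + 1)) t := by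
  refine HasDerivAt.prodMk (by simpa using (hasDerivAt_id t).const_add w.1)
    (hasDerivAt_pi.2 fun i => ?_)
  refine (hasDerivAt_flow_u w t i).congr_of_eventuallyEq (.of_forall fun s => ?_)
  exact (flow_u w s i).symm

theorem flow_flow (w : Jet p) (s t : ℝ) : flow (flow w s) t = flow w (s + t) := by
  refine Jet.ext_u (by simp [add_assoc]) fun J _ => ?_
  -- Descending induction on `J` from the range where `u⁽ᴶ⁾` is zero: both sides agree at `t = 0`,
  -- and their `t`-derivatives are the two sides for `J + 1`.
  have key : ∀ n J : ℕ, 2 * p + 1 ≤ J + n → ∀ t, (flow (flow w s) t).u J = (flow w (s + t)).u J := by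
    intro n
    induction n with
    | zero =>
      intro J hJ t
      rw [Jet.u_of_le (by omega), Jet.u_of_le (by omega)]
    | succ n ih =>
      intro J hJ t
      have hd : ∀ t, HasDerivAt (fun t => (flow (flow w s) t).u J - (flow w (s + t)).u J) 0 t := by
        intro t
        have h2 := (hasDerivAt_flow_u w (s + t) J).comp_const_add s t
        refine ((hasDerivAt_flow_u (flow w s) t J).sub h2).congr_deriv ?_
        rw [ih (J + 1) (by omega) t, sub_self]
      have hconst := is_const_of_deriv_eq_zero (fun t => (hd t).differentiableAt)
        (fun t => (hd t).deriv) t 0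
      simpa [flow_zero, sub_eq_zero] using hconst
  exact key (2 * p + 1) J (by omega) t

variable {Ω : Set (ℝ × ℝ)}

theorem isOpen_base_mem (hΩ : IsOpen Ω) : IsOpen {w : Jet p | w.base ∈ Ω} :=
  hΩ.preimage (Jet.contDiff_base (n := 0)).continuous

theorem hasDerivAt_comp_flow {ψ : Jet p → ℝ} {w : Jet p} {t : ℝ}
    (hψ : DifferentiableAt ℝ ψ (flow w t)) :
    HasDerivAt (fun t => ψ (flow w t)) (totalDeriv ψ (flow w t)) t :=
  hψ.hasFDerivAt.comp_hasDerivAt t (hasDerivAt_flow w t)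

theorem contDiffOn_totalDeriv (hΩ : IsOpen Ω) {ψ : Jet p → ℝ}
    (hψ : ContDiffOn ℝ ∞ ψ {w | w.base ∈ Ω}) :
    ContDiffOn ℝ ∞ (totalDeriv ψ) {w : Jet p | w.base ∈ Ω} := by
  have h := hψ.fderiv_of_isOpen (isOpen_base_mem hΩ) (m := ∞) (by simp)
  refine h.clm_apply (ContDiff.contDiffOn ?_)
  exact contDiff_const.prodMk (contDiff_pi.2 fun i => Jet.contDiff_u _)

theorem contDiffOn_iterate_totalDeriv (hΩ : IsOpen Ω) {ψ : Jet p → ℝ}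
    (hψ : ContDiffOn ℝ ∞ ψ {w | w.base ∈ Ω}) (l : ℕ) :
    ContDiffOn ℝ ∞ (totalDeriv^[l] ψ) {w : Jet p | w.base ∈ Ω} := by
  induction l generalizing ψ with
  | zero => exact hψ
  | succ l ih => exact ih (contDiffOn_totalDeriv hΩ hψ)

theorem contDiffAt_of_base_mem (hΩ : IsOpen Ω) {ψ : Jet p → ℝ}
    (hψ : ContDiffOn ℝ ∞ ψ {w | w.base ∈ Ω}) {w : Jet p} (hw : w.base ∈ Ω) :
    ContDiffAt ℝ ∞ ψ w := hψ.contDiffAt ((isOpen_base_mem hΩ).mem_nhds hw)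

theorem tendsto_flow (w : Jet p) : Tendsto (flow w) (𝓝 0) (𝓝 w) := by
  have := (hasDerivAt_flow w 0).continuousAt.tendsto
  rwa [flow_zero] at this

/-- Taylor's formula along the flow. -/
theorem isLittleO_taylor_flow (hΩ : IsOpen Ω) {ψ : Jet p → ℝ}
    (hψ : ContDiffOn ℝ ∞ ψ {w | w.base ∈ Ω}) {w : Jet p} (hw : w.base ∈ Ω) (n : ℕ) :
    (fun t => ψ (flow w t) - ∑ l ∈ Finset.range (n + 1),
      t ^ l / (l.factorial : ℝ) * (totalDeriv^[l] ψ) w) =o[𝓝 0] fun t => t ^ n := by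
  have hev : ∀ᶠ t in 𝓝 (0 : ℝ), (flow w t).base ∈ Ω :=
    (tendsto_flow w).eventually ((isOpen_base_mem hΩ).mem_nhds hw)
  induction n generalizing ψ with
  | zero =>
    have h := (contDiffAt_of_base_mem hΩ hψ hw).continuousAt.tendsto.comp (tendsto_flow w)
    simpa [isLittleO_one_iff, Function.comp_def] using h.sub_const (ψ w)
  | succ n ih =>
    refine isLittleO_of_hasDerivAt (hev.mono fun t ht => ?_) ?_ (ih (contDiffOn_totalDeriv hΩ hψ))
    · refine (hasDerivAt_comp_flow
        ((contDiffAt_of_base_mem hΩ hψ ht).differentiableAt (by simp))).sub ?_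
      have h : ∀ l ∈ Finset.range (n + 1), HasDerivAt (fun t : ℝ =>
          t ^ (l + 1) / ((l + 1).factorial : ℝ) * (totalDeriv^[l + 1] ψ) w)
          (t ^ l / (l.factorial : ℝ) * (totalDeriv^[l] (totalDeriv ψ)) w) t := by
        intro l _
        refine (((hasDerivAt_pow (l + 1) t).div_const _).mul_const _).congr_deriv ?_
        rw [Nat.add_sub_cancel, Nat.factorial_succ, Function.iterate_succ_apply]
        have : ((l : ℝ) + 1) ≠ 0 := by positivity
        push_cast
        field_simp
      refine ((HasDerivAt.fun_sum h).add_const (ψ w)).congr_of_eventuallyEq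
        (.of_forall fun s => ?_)
      simp only
      rw [Finset.sum_range_succ']
      simp
    · rw [Finset.sum_range_succ']
      simp [flow_zero]

theorem totalDeriv_eq_of_hasDerivAt {ψ : Jet p → ℝ} {w : Jet p} {d : ℝ}
    (hψ : DifferentiableAt ℝ ψ w) (h : HasDerivAt (fun t => ψ (flow w t)) d 0) :
    totalDeriv ψ w = d := by
  rw [← flow_zero w] at hψ
  have := (hasDerivAt_comp_flow hψ).unique h
  rwa [flow_zero] at this

theorem hasDerivAt_comp_flow_zero (hΩ : IsOpen Ω) {ψ : Jet p → ℝ}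
    (hψ : ContDiffOn ℝ ∞ ψ {w | w.base ∈ Ω}) {w : Jet p} (hw : w.base ∈ Ω) :
    HasDerivAt (fun t => ψ (flow w t)) (totalDeriv ψ w) 0 := by
  have hd := (contDiffAt_of_base_mem hΩ hψ hw).differentiableAt (by simp)
  rw [← flow_zero w] at hd
  have := hasDerivAt_comp_flow hd
  rwa [flow_zero] at this

end Flow

/-! ### The prolongation recursion and Leibniz sums -/

section Prolongation

variable {p : ℕ} {Ω : Set (ℝ × ℝ)}

/-- The Leibniz sum `∑_{1 ≤ i ≤ l} (l choose i) Dⁱχ u⁽ᴶ⁺¹⁺ˡ⁻ⁱ⁾`, by which `Dˡφ⁽ᴶ⁾` differs from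
`φ⁽ᴶ⁺ˡ⁾` for the prolongation of a vector field with `∂ₓ`-coefficient `χ`. -/
noncomputable def leibnizSum (χ : Jet p → ℝ) (l J : ℕ) (w : Jet p) : ℝ :=
  ∑ i ∈ Finset.range l, (l.choose (i + 1) : ℝ) * (totalDeriv^[i + 1] χ) w * w.u (J + l - i)

/-- Product rule and Pascal's rule. The differentiated sum lacks only the `(l choose 0)` share of
the first term of the sum for `l + 1`, which is the subtracted product. -/
theorem hasDerivAt_leibnizSum (hΩ : IsOpen Ω) {χ : Jet p → ℝ}
    (hχ : ContDiffOn ℝ ∞ χ {w | w.base ∈ Ω}) (l J : ℕ) {w : Jet p} (hw : w.base ∈ Ω) :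
    HasDerivAt (fun t => leibnizSum χ l J (flow w t))
      (leibnizSum χ (l + 1) J w - w.u (J + l + 1) * totalDeriv χ w) 0 := by
  unfold leibnizSum
  have h : ∀ i ∈ Finset.range l, HasDerivAt (fun t : ℝ => (l.choose (i + 1) : ℝ) *
      (totalDeriv^[i + 1] χ) (flow w t) * (flow w t).u (J + l - i))
      ((l.choose (i + 1) : ℝ) * (totalDeriv^[i + 2] χ) w * w.u (J + l - i) +
        (l.choose (i + 1) : ℝ) * (totalDeriv^[i + 1] χ) w * w.u (J + l - i + 1)) 0 := by
    intro i _
    have h1 := hasDerivAt_comp_flow_zero hΩ (contDiffOn_iterate_totalDeriv hΩ hχ (i + 1)) hw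
    have h2 := hasDerivAt_flow_u w 0 (J + l - i)
    have h3 := (h1.const_mul (l.choose (i + 1) : ℝ)).mul h2
    rw [flow_zero, ← Function.iterate_succ_apply' totalDeriv] at h3
    exact h3
  refine (HasDerivAt.fun_sum h).congr_deriv ?_
  rw [Finset.sum_add_distrib]
  simp only [Nat.choose_succ_succ' l, Nat.cast_add, add_mul, Finset.sum_add_distrib]
  rw [Finset.sum_range_succ' (fun i => (l.choose i : ℝ) * (totalDeriv^[i + 1] χ) w *
    w.u (J + (l + 1) - i)), Finset.sum_range_succ (fun i => (l.choose (i + 1) : ℝ) *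
    (totalDeriv^[i + 1] χ) w * w.u (J + (l + 1) - i)), Nat.choose_succ_self]
  have e1 : ∀ i, J + (l + 1) - (i + 1) = J + l - i := fun i => by omega
  have e2 : ∑ i ∈ Finset.range l, (l.choose (i + 1) : ℝ) * (totalDeriv^[i + 1] χ) w *
      w.u (J + (l + 1) - i) = ∑ i ∈ Finset.range l, (l.choose (i + 1) : ℝ) *
      (totalDeriv^[i + 1] χ) w * w.u (J + l - i + 1) := by
    refine Finset.sum_congr rfl fun i hi => ?_
    have := Finset.mem_range.1 hi
    rw [show J + (l + 1) - i = J + l - i + 1 by omega]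
  simp only [e1, e2]
  simp only [Nat.choose_zero_right, Nat.cast_one, one_mul, zero_add, Function.iterate_one,
    Nat.sub_zero, Nat.cast_zero, zero_mul, add_zero, ← add_assoc]
  ring

theorem totalDeriv_add_leibnizSum (hΩ : IsOpen Ω) {ψ χ : Jet p → ℝ}
    (hψ : ContDiffOn ℝ ∞ ψ {w | w.base ∈ Ω}) (hχ : ContDiffOn ℝ ∞ χ {w | w.base ∈ Ω}) (l J : ℕ)
    {ρ : Jet p → ℝ} (hρ : ContDiffOn ℝ ∞ ρ {w | w.base ∈ Ω})
    (h : ∀ w : Jet p, w.base ∈ Ω → ρ w = ψ w + leibnizSum χ l J w) {w : Jet p}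
    (hw : w.base ∈ Ω) :
    totalDeriv ρ w = totalDeriv ψ w +
      (leibnizSum χ (l + 1) J w - w.u (J + l + 1) * totalDeriv χ w) := by
  refine totalDeriv_eq_of_hasDerivAt ((contDiffAt_of_base_mem hΩ hρ hw).differentiableAt (by simp))
    (((hasDerivAt_comp_flow_zero hΩ hψ hw).add
      (hasDerivAt_leibnizSum hΩ hχ l J hw)).congr_of_eventuallyEq ?_)
  filter_upwards [(tendsto_flow w).eventually ((isOpen_base_mem hΩ).mem_nhds hw)] with t ht
  exact h _ ht

/-- Applying `D` to the relation for `j` gives the relation for `j + 1` up to exactly one instance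
of the recursion, so the two families are equivalent one index at a time. -/
theorem forall_iterate_totalDeriv_eq_iff (hΩ : IsOpen Ω) {ψ : ℕ → Jet p → ℝ} {χ : Jet p → ℝ}
    {J l : ℕ} (hψ : ∀ j ≤ J + l, ContDiffOn ℝ ∞ (ψ j) {w | w.base ∈ Ω})
    (hχ : ContDiffOn ℝ ∞ χ {w | w.base ∈ Ω}) :
    (∀ j ≤ l, ∀ w : Jet p, w.base ∈ Ω →
      (totalDeriv^[j] (ψ J)) w = ψ (J + j) w + leibnizSum χ j J w) ↔
    ∀ j < l, ∀ w : Jet p, w.base ∈ Ω →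
      ψ (J + j + 1) w = totalDeriv (ψ (J + j)) w - w.u (J + j + 1) * totalDeriv χ w := by
  constructor
  · intro h j hj w hw
    have h1 := h (j + 1) hj w hw
    rw [Function.iterate_succ_apply', totalDeriv_add_leibnizSum hΩ (hψ (J + j) (by omega)) hχ j J
      (contDiffOn_iterate_totalDeriv hΩ (hψ J (by omega)) j) (h j hj.le) hw] at h1
    rw [add_assoc J j 1]
    rw [add_assoc J j 1] at h1
    linarith
  · intro h j hj
    induction j with
    | zero => simp [leibnizSum]
    | succ j ih =>
      intro w hw
      rw [Function.iterate_succ_apply', totalDeriv_add_leibnizSum hΩ (hψ (J + j) (by omega)) hχ j J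
        (contDiffOn_iterate_totalDeriv hΩ (hψ J (by omega)) j) (ih (by omega)) hw]
      have := h j hj w hw
      rw [← add_assoc, this]
      ring

/-- The inner sum on the right is the value prescribed for `σ` at index `n - k`. Thus the Leibniz
terms of a prolongation are matched exactly by the variation of the step sizes. -/
theorem sum_leibnizSum {χ : ℕ → Jet p → ℝ} (n J : ℕ) (h : ℝ) (w : Jet p) :
    ∑ k ∈ Finset.Icc 1 n, h ^ k / (k.factorial : ℝ) * leibnizSum (χ (n - k)) k J w =
      ∑ k ∈ Finset.Icc 1 n, h ^ (k - 1) / ((k - 1).factorial : ℝ) *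
        (∑ l ∈ Finset.Icc 1 (n - k + 1),
          h ^ l / (l.factorial : ℝ) * (totalDeriv^[l] (χ (n - k + 1 - l))) w) * w.u (J + k) := by
  simp only [leibnizSum, Finset.mul_sum, Finset.sum_mul]
  rw [Finset.sum_sigma', Finset.sum_sigma']
  -- A term with `k` and `D^(i+1)χ` is assigned to the order `l = i + 1` of the derivative and to
  -- the index `k - i` of the remaining `u⁽ᴶ⁺ᵏ⁻ⁱ⁾`.
  refine Finset.sum_bij' (fun a _ => ⟨a.1 - a.2, a.2 + 1⟩) (fun b _ => ⟨b.1 + b.2 - 1, b.2 - 1⟩)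
    ?_ ?_ ?_ ?_ ?_
  · rintro ⟨a, b⟩ h
    simp only [Finset.mem_sigma, Finset.mem_Icc, Finset.mem_range] at h ⊢
    omega
  · rintro ⟨a, b⟩ h
    simp only [Finset.mem_sigma, Finset.mem_Icc, Finset.mem_range] at h ⊢
    omega
  · rintro ⟨a, b⟩ h
    simp only [Finset.mem_sigma, Finset.mem_Icc, Finset.mem_range] at h ⊢
    simp only [Sigma.mk.injEq, heq_eq_eq]
    omega
  · rintro ⟨a, b⟩ h
    simp only [Finset.mem_sigma, Finset.mem_Icc] at h ⊢
    simp only [Sigma.mk.injEq, heq_eq_eq]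
    omega
  · rintro ⟨a, b⟩ hab
    simp only [Finset.mem_sigma, Finset.mem_Icc, Finset.mem_range] at hab ⊢
    obtain ⟨c, rfl⟩ : ∃ c, a = b + 1 + c := ⟨a - b - 1, by omega⟩
    have e1 : n - (b + 1 + c - b) + 1 - (b + 1) = n - (b + 1 + c) := by omega
    have e2 : b + 1 + c - b - 1 = c := by omega
    have e3 : J + (b + 1 + c - b) = J + (b + 1 + c) - b := by omega
    rw [e1, e2, e3]
    have hch : ((b + 1 + c).choose (b + 1) : ℝ) =
        ((b + 1 + c).factorial : ℝ) / (((b + 1).factorial : ℝ) * (c.factorial : ℝ)) :=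
      Nat.cast_add_choose ℝ
    rw [hch, pow_add h (b + 1) c]
    have f1 : ((b + 1 + c).factorial : ℝ) ≠ 0 := by positivity
    field_simp

end Prolongation

/-! ### The determining equations, order by order in `ε` -/

namespace Coefficients

variable {p r M : ℕ} {Ω : Set (ℝ × ℝ)} (X : Coefficients p r M Ω)

theorem contDiffOn_ξJet {k : ℕ} (hk : k ≤ r) :
    ContDiffOn ℝ ∞ (X.ξJet k) {w : Jet p | w.base ∈ Ω} :=
  (X.ξ_smooth k hk).comp Jet.contDiff_base.contDiffOn fun _ hw => hw

/-- The component of `X_m` on a node which governs the equation `i` of the system. -/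
def component (m : ℕ) : Fin M ⊕ (Fin M × Fin (p + 1)) → Jet p → ℝ
  | Sum.inl _ => X.ξJet m
  | Sum.inr (_, J) => X.φ m J

/-- The coefficient of `ε ^ (m + k)` which the derivative along `ε ^ m X_m` of the subtracted terms
of the equation `i` contributes. -/
noncomputable def stepPart (m k : ℕ) :
    Fin M ⊕ (Fin M × Fin (p + 1)) → Jet p → (Fin M → ℝ) → ℝ
  | Sum.inl α, w, h => if k = 1 then X.σ m α w h else 0
  | Sum.inr (α, J), w, h => h α ^ k / (k.factorial : ℝ) * X.φ m (J + k) w +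
      h α ^ (k - 1) / ((k - 1).factorial : ℝ) * X.σ m α w h * w.u (J + k)

end Coefficients

/-- The step to which an equation of the system belongs. -/
def stepIndex {p M : ℕ} : Fin M ⊕ (Fin M × Fin (p + 1)) → Fin M :=
  Sum.elim id Prod.fst

theorem eq_zero_of_forall_sum_pow {n : ℕ} {c : ℕ → ℝ}
    (h : ∀ t : ℝ, ∑ k ∈ Finset.Icc 1 n, t ^ k / (k.factorial : ℝ) * c k = 0) :
    ∀ k, 1 ≤ k → k ≤ n → c k = 0 := by
  intro k hk hkn
  have h2 := coeff_eq_zero_of_isLittleO (n := n)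
    (c := fun k => if k = 0 then 0 else (k.factorial : ℝ)⁻¹ * c k) (by
      have : (fun t : ℝ => ∑ i ∈ Finset.range (n + 1), t ^ i •
          (if i = 0 then 0 else (i.factorial : ℝ)⁻¹ * c i)) = fun _ => 0 := by
        funext t
        refine Eq.trans ?_ (h t)
        rw [Finset.range_eq_Ico, Finset.sum_eq_sum_Ico_succ_bot (by omega), if_pos rfl,
          smul_zero, zero_add]
        refine Finset.sum_congr (by ext; simp) fun i hi => ?_
        have := (Finset.mem_Icc.1 hi).1
        rw [if_neg (by omega), smul_eq_mul]
        ring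
      rw [this]
      exact isLittleO_zero _ _) k hkn
  have h3 : (k.factorial : ℝ) ≠ 0 := by positivity
  have h4 : k ≠ 0 := by omega
  simpa [h4, h3] using h2

namespace Coefficients

variable {p r M : ℕ} {Ω : Set (ℝ × ℝ)} (X : Coefficients p r M Ω)

/-- In the `x`-equation of order `n` only `k = 1` carries a `σ`, namely that of index `n - 1`, so
the equation can be solved for it. After this substitution the bracket of each `h^k / k!` in the
`u⁽ᴶ⁾`-equations is free of `h`, and comparison of powers of `h` separates the different `k`. -/
theorem forall_sum_eq_zero_iff (hrp : r ≤ p) (hM : 1 ≤ M) (hΩ : IsOpen Ω) :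
    (∀ i, ∀ w : Jet p, w.base ∈ Ω → ∀ h : Fin M → ℝ, ∀ n, 1 ≤ n → n ≤ r →
      ∑ k ∈ Finset.Icc 1 n, (h (stepIndex i) ^ k / (k.factorial : ℝ) *
        (totalDeriv^[k] (X.component (n - k) i)) w - X.stepPart (n - k) k i w h) = 0) ↔
    (∀ k < r, ∀ α : Fin M, ∀ w : Jet p, w.base ∈ Ω → ∀ h : Fin M → ℝ,
        X.σ k α w h = ∑ l ∈ Finset.Icc 1 (k + 1),
          h α ^ l / (l.factorial : ℝ) * (totalDeriv^[l] (X.ξJet (k + 1 - l))) w) ∧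
      (∀ k < r, ∀ J : ℕ, J + k < p + r → ∀ w : Jet p, w.base ∈ Ω →
        X.φ k (J + 1) w =
          totalDeriv (X.φ k J) w - w.u (J + 1) * totalDeriv (X.ξJet k) w) := by
  have hinl : (∀ α : Fin M, ∀ w : Jet p, w.base ∈ Ω → ∀ h : Fin M → ℝ, ∀ n, 1 ≤ n → n ≤ r →
      ∑ k ∈ Finset.Icc 1 n, (h α ^ k / (k.factorial : ℝ) *
        (totalDeriv^[k] (X.ξJet (n - k))) w - if k = 1 then X.σ (n - k) α w h else 0) = 0) ↔
      ∀ k < r, ∀ α : Fin M, ∀ w : Jet p, w.base ∈ Ω → ∀ h : Fin M → ℝ,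
        X.σ k α w h = ∑ l ∈ Finset.Icc 1 (k + 1),
          h α ^ l / (l.factorial : ℝ) * (totalDeriv^[l] (X.ξJet (k + 1 - l))) w := by
    have key : ∀ n, 1 ≤ n → ∀ (α : Fin M) (w : Jet p) (h : Fin M → ℝ),
        ∑ k ∈ Finset.Icc 1 n, (h α ^ k / (k.factorial : ℝ) *
        (totalDeriv^[k] (X.ξJet (n - k))) w - if k = 1 then X.σ (n - k) α w h else 0) =
        (∑ k ∈ Finset.Icc 1 n, h α ^ k / (k.factorial : ℝ) *
        (totalDeriv^[k] (X.ξJet (n - k))) w) - X.σ (n - 1) α w h := by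
      intro n hn α w h
      rw [Finset.sum_sub_distrib, Finset.sum_ite_eq' (Finset.Icc 1 n) 1,
        if_pos (Finset.mem_Icc.2 ⟨le_rfl, hn⟩)]
    constructor
    · intro H k hk α w hw h
      have := H α w hw h (k + 1) (by omega) (by omega)
      rw [key _ (by omega), Nat.add_sub_cancel] at this
      linarith
    · intro H α w hw h n hn hnr
      obtain ⟨k, rfl⟩ : ∃ k, n = k + 1 := ⟨n - 1, by omega⟩
      rw [key _ hn, Nat.add_sub_cancel, H k (by omega) α w hw h]
      ring
  have hinr : (∀ k < r, ∀ α : Fin M, ∀ w : Jet p, w.base ∈ Ω → ∀ h : Fin M → ℝ,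
        X.σ k α w h = ∑ l ∈ Finset.Icc 1 (k + 1),
          h α ^ l / (l.factorial : ℝ) * (totalDeriv^[l] (X.ξJet (k + 1 - l))) w) →
      ∀ (α : Fin M) (J : ℕ) (w : Jet p), w.base ∈ Ω → ∀ h : Fin M → ℝ, ∀ n, 1 ≤ n → n ≤ r →
      ∑ k ∈ Finset.Icc 1 n, (h α ^ k / (k.factorial : ℝ) *
        (totalDeriv^[k] (X.φ (n - k) J)) w - (h α ^ k / (k.factorial : ℝ) * X.φ (n - k) (J + k) w +
      h α ^ (k - 1) / ((k - 1).factorial : ℝ) * X.σ (n - k) α w h * w.u (J + k))) =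
      ∑ k ∈ Finset.Icc 1 n, h α ^ k / (k.factorial : ℝ) *
        ((totalDeriv^[k] (X.φ (n - k) J)) w - X.φ (n - k) (J + k) w -
          leibnizSum (X.ξJet (n - k)) k J w) := by
    intro hσ α J w hw h n hn hnr
    simp only [mul_sub, Finset.sum_sub_distrib, Finset.sum_add_distrib]
    rw [sum_leibnizSum, sub_sub]
    congr 2
    refine Finset.sum_congr rfl fun k hk => ?_
    have := Finset.mem_Icc.1 hk
    rw [hσ (n - k) (by omega) α w hw h]
  have hsm : ∀ k < r, ∀ J, ∀ l, J + l ≤ 2 * p → ((∀ j ≤ l, ∀ w : Jet p, w.base ∈ Ω →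
      (totalDeriv^[j] (X.φ k J)) w = X.φ k (J + j) w + leibnizSum (X.ξJet k) j J w) ↔
      ∀ j < l, ∀ w : Jet p, w.base ∈ Ω → X.φ k (J + j + 1) w =
        totalDeriv (X.φ k (J + j)) w - w.u (J + j + 1) * totalDeriv (X.ξJet k) w) :=
    fun k hk J l hJl => forall_iterate_totalDeriv_eq_iff hΩ
      (fun j hj => X.φ_smooth k hk.le j (by omega)) (X.contDiffOn_ξJet hk.le)
  constructor
  · intro H
    have hσ := hinl.1 fun α => H (Sum.inl α)
    refine ⟨hσ, ?_⟩
    have hφ : ∀ k < r, ∀ J ≤ p, ∀ j, k + j ≤ r → ∀ w : Jet p, w.base ∈ Ω →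
        (totalDeriv^[j] (X.φ k J)) w = X.φ k (J + j) w + leibnizSum (X.ξJet k) j J w := by
      intro k hk J hJ j hj w hw
      rcases Nat.eq_zero_or_pos j with rfl | hj0
      · simp [leibnizSum]
      · have := eq_zero_of_forall_sum_pow (n := k + j) (c := fun i =>
          (totalDeriv^[i] (X.φ (k + j - i) J)) w - X.φ (k + j - i) (J + i) w -
            leibnizSum (X.ξJet (k + j - i)) i J w) (fun t => by
            -- One step, with all step sizes equal to `t`, already suffices to obtain a polynomial
            -- identity in `t`.
            have h1 := H (Sum.inr (⟨0, hM⟩, ⟨J, by omega⟩)) w hw (fun _ => t) (k + j)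
              (by omega) hj
            have h2 := hinr hσ ⟨0, hM⟩ J w hw (fun _ => t) (k + j) (by omega) hj
            exact h2.symm.trans h1) j hj0 (by omega)
        rw [Nat.add_sub_cancel] at this
        linarith
    intro k hk J hJ w hw
    -- The system has equations only for `J₀ ≤ p`; the recursion at orders above `p` is reached
    -- through the iterates `D^(s+1) φ⁽ᵖ⁾` with `s + 1 ≤ r - k`. This accounts for the bound `J + k
    -- < p + r`.
    obtain ⟨J₀, s, rfl, hJ₀, hs⟩ : ∃ J₀ s, J = J₀ + s ∧ J₀ ≤ p ∧ k + s + 1 ≤ r := by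
      rcases le_total J p with h | h
      · exact ⟨J, 0, rfl, h, by omega⟩
      · exact ⟨p, J - p, by omega, le_rfl, by omega⟩
    exact (hsm k hk J₀ (s + 1) (by omega)).1
      (fun j hj => hφ k hk J₀ hJ₀ j (by omega)) s (by omega) w hw
  · rintro ⟨hσ, hφ⟩ i
    rcases i with α | ⟨α, J⟩
    · exact hinl.2 hσ α
    · intro w hw h n hn hnr
      refine (hinr hσ α J w hw h n hn hnr).trans (Finset.sum_eq_zero fun k hk => ?_)
      have hk' := Finset.mem_Icc.1 hk
      have hJ := J.2
      have := (hsm (n - k) (by omega) J k (by omega)).2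
        (fun j hj v hv => hφ (n - k) (by omega) (J + j) (by omega) v hv) k le_rfl w hw
      rw [this]
      ring

end Coefficients

/-! ### The linearised system -/

section System

variable {p r M : ℕ}

theorem Jet.hasDerivAt_u {c : ℝ → Jet p} {c' : Jet p} {a : ℝ} (hc : HasDerivAt c c' a) (j : ℕ) :
    HasDerivAt (fun s => (c s).u j) (c'.u j) a := by
  unfold Jet.u
  split_ifs with hj
  · exact hasDerivAt_pi.1 hc.snd ⟨j, hj⟩
  · exact hasDerivAt_const _ _

/-- The derivative of the left-hand side of the equation `i` at `z` in the direction `Y`. -/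
noncomputable def taylorSystemDeriv (r : ℕ) :
    Fin M ⊕ (Fin M × Fin (p + 1)) → Grid p M → ℝ → Grid p M → ℝ
  | Sum.inl α, _, ε, Y => (Y.1 α.succ).1 - (Y.1 α.castSucc).1 - ε * Y.2 α
  | Sum.inr (α, J), z, ε, Y =>
      (Y.1 α.succ).u J - (Y.1 α.castSucc).u J
        - ∑ k ∈ Finset.Icc 1 r,
            (ε ^ k / (k.factorial : ℝ) * (k * z.2 α ^ (k - 1) * Y.2 α) * (z.1 α.castSucc).u (J + k)
              + ε ^ k / (k.factorial : ℝ) * z.2 α ^ k * (Y.1 α.castSucc).u (J + k))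

theorem hasDerivAt_taylorSystem (i : Fin M ⊕ (Fin M × Fin (p + 1))) {c : ℝ → Grid p M}
    {c' : Grid p M} {a : ℝ} (hc : HasDerivAt c c' a) (ε : ℝ) :
    HasDerivAt (fun s => taylorSystem p r M i (c s) ε) (taylorSystemDeriv r i (c a) ε c') a := by
  have h1 : ∀ α, HasDerivAt (fun s => (c s).1 α) (c'.1 α) a := hasDerivAt_pi.1 hc.fst
  have h2 : ∀ α, HasDerivAt (fun s => (c s).2 α) (c'.2 α) a := hasDerivAt_pi.1 hc.snd
  rcases i with α | ⟨α, J⟩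
  · have h3 : ∀ α, HasDerivAt (fun s => ((c s).1 α).1) (c'.1 α).1 a := fun α => (h1 α).fst
    exact ((h3 _).sub (h3 _)).sub ((h2 α).const_mul ε)
  · refine ((Jet.hasDerivAt_u (h1 _) _).sub (Jet.hasDerivAt_u (h1 _) _)).sub
      (HasDerivAt.fun_sum fun k _ => ?_)
    exact (((h2 α).fun_pow k).const_mul _).mul (Jet.hasDerivAt_u (h1 _) _)

theorem contDiff_taylorSystem {n : ℕ∞ω} (i : Fin M ⊕ (Fin M × Fin (p + 1))) :
    ContDiff ℝ n (fun q : Grid p M × ℝ => taylorSystem p r M i q.1 q.2) := by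
  rcases i with α | ⟨α, J⟩
  · unfold taylorSystem
    fun_prop
  · unfold taylorSystem
    simp only [div_eq_mul_inv]
    fun_prop

theorem contDiff_taylorSystemDeriv {n : ℕ∞ω} (i : Fin M ⊕ (Fin M × Fin (p + 1))) :
    ContDiff ℝ n (fun q : Grid p M × ℝ × Grid p M => taylorSystemDeriv r i q.1 q.2.1 q.2.2) := by
  rcases i with α | ⟨α, J⟩
  · unfold taylorSystemDeriv
    fun_prop
  · unfold taylorSystemDeriv
    simp only [div_eq_mul_inv]
    fun_prop

theorem isOpen_gridDomain {Ω : Set (ℝ × ℝ)} (hΩ : IsOpen Ω) : IsOpen (gridDomain p M Ω) := by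
  simp only [gridDomain, Set.ofPred_forall]
  refine isOpen_iInter_of_finite fun α => ?_
  exact (isOpen_base_mem hΩ).preimage (f := fun z : Grid p M => z.1 α) (by fun_prop)

end System

/-! ### The operator on exact grids and its expansion in `ε` -/

theorem sum_pow_mul_isLittleO (r : ℕ) (c : ℕ → ℕ → ℝ) :
    (fun ε : ℝ => ∑ m ∈ Finset.range (r + 1), ∑ k ∈ Finset.Icc 1 r, ε ^ (m + k) * c m k -
      ∑ n ∈ Finset.range (r + 1), ε ^ n • ∑ k ∈ Finset.Icc 1 n, c (n - k) k)
      =o[𝓝 0] fun ε => ε ^ r := by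
  have h : ∀ ε : ℝ, ∑ m ∈ Finset.range (r + 1), ∑ k ∈ Finset.Icc 1 r, ε ^ (m + k) * c m k -
      ∑ n ∈ Finset.range (r + 1), ε ^ n • ∑ k ∈ Finset.Icc 1 n, c (n - k) k =
      ∑ q ∈ (Finset.range (r + 1) ×ˢ Finset.Icc 1 r) with ¬ q.1 + q.2 ≤ r,
        ε ^ (q.1 + q.2) * c q.1 q.2 := by
    intro ε
    -- Terms with `m + k ≤ r` are regrouped by `n = m + k`; all others have exponent greater than
    -- `r`.
    rw [← Finset.sum_product', ← Finset.sum_filter_add_sum_filter_not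
      (Finset.range (r + 1) ×ˢ Finset.Icc 1 r) (fun q : ℕ × ℕ => q.1 + q.2 ≤ r)]
    rw [add_sub_right_comm, add_eq_right, sub_eq_zero]
    simp only [smul_eq_mul, Finset.mul_sum]
    rw [Finset.sum_sigma']
    refine Finset.sum_bij' (fun q _ => ⟨q.1 + q.2, q.2⟩) (fun s _ => (s.1 - s.2, s.2)) ?_ ?_ ?_ ?_ ?_
    · rintro ⟨m, k⟩ hq
      simp only [Finset.mem_filter, Finset.mem_product, Finset.mem_range, Finset.mem_Icc,
        Finset.mem_sigma] at hq ⊢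
      omega
    · rintro ⟨n, k⟩ hq
      simp only [Finset.mem_filter, Finset.mem_product, Finset.mem_range, Finset.mem_Icc,
        Finset.mem_sigma] at hq ⊢
      omega
    · rintro ⟨m, k⟩ hq
      simp
    · rintro ⟨n, k⟩ hq
      simp only [Finset.mem_range, Finset.mem_Icc, Finset.mem_sigma] at hq
      simp only [Sigma.mk.injEq, heq_eq_eq, and_true]
      omega
    · rintro ⟨m, k⟩ hq
      simp
  simp only [h]
  refine IsLittleO.fun_sum fun q hq => ?_
  have hlt : r < q.1 + q.2 := by simpa using (Finset.mem_filter.1 hq).2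
  simpa [mul_comm] using (isLittleO_pow_pow (𝕜 := ℝ) hlt).const_mul_left (c q.1 q.2)

namespace Coefficients

variable {p r M : ℕ} {Ω : Set (ℝ × ℝ)} (X : Coefficients p r M Ω)

/-- The truncated operator `∑_{m ≤ r} ε ^ m X_m`. -/
noncomputable def approxField (z : Grid p M) (ε : ℝ) : Grid p M :=
  ∑ m ∈ Finset.range (r + 1), ε ^ m • X.field m z

/-- The value which the operator gives the left-hand side of the equation `i` of the system on grids
with exact step `w ↦ flow w (ε h)`. -/
noncomputable def defect (i : Fin M ⊕ (Fin M × Fin (p + 1))) (w : Jet p) (h : Fin M → ℝ)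
    (ε : ℝ) : ℝ :=
  ∑ m ∈ Finset.range (r + 1),
    ε ^ m * (X.component m i (flow w (ε * h (stepIndex i))) - X.component m i w) -
  ∑ m ∈ Finset.range (r + 1), ∑ k ∈ Finset.Icc 1 r, ε ^ (m + k) * X.stepPart m k i w h

theorem contDiffOn_component (m : ℕ) (hm : m ≤ r) (i : Fin M ⊕ (Fin M × Fin (p + 1))) :
    ContDiffOn ℝ ∞ (X.component m i) {w | w.base ∈ Ω} := by
  rcases i with α | ⟨α, J⟩
  · exact X.contDiffOn_ξJet hm
  · exact X.φ_smooth m hm J (by omega)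

/-- The system stops at `J ≤ p`, where `max J p = p`. Hence these coefficients see only coordinates
that the system controls from one node to the next. -/
theorem hasOrderLE_component (m : ℕ) (hm : m ≤ r) (i : Fin M ⊕ (Fin M × Fin (p + 1))) :
    HasOrderLE Ω p (X.component m i) := by
  rcases i with α | ⟨α, J⟩
  · intro w w' _ _ h1 h2
    simp only [component, ξJet, Jet.base]
    rw [h1, h2 0 (Nat.zero_le p)]
  · have hJ := J.2
    have := X.φ_order m hm J (by omega)
    rwa [max_eq_right (by omega)] at this

theorem contDiffAt_stepPart (hΩ : IsOpen Ω) (hrp : r ≤ p) {m k : ℕ} (hm : m ≤ r) (hk : k ≤ r)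
    (i : Fin M ⊕ (Fin M × Fin (p + 1))) {w : Jet p} (hw : w.base ∈ Ω) (h : Fin M → ℝ) :
    ContDiffAt ℝ ∞ (fun q : Jet p × (Fin M → ℝ) => X.stepPart m k i q.1 q.2) (w, h) := by
  have hσ : ∀ α, ContDiffAt ℝ ∞ (fun q : Jet p × (Fin M → ℝ) => X.σ m α q.1 q.2) (w, h) :=
    fun α => (X.σ_smooth m hm α).contDiffAt
      (((isOpen_base_mem hΩ).preimage continuous_fst).mem_nhds hw)
  rcases i with α | ⟨α, J⟩
  · simp only [stepPart]
    split_ifs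
    · exact hσ α
    · exact contDiffAt_const
  · have hJ := J.2
    have hφ : ContDiffAt ℝ ∞ (fun q : Jet p × (Fin M → ℝ) => X.φ m (J + k) q.1) (w, h) :=
      ContDiffAt.comp (w, h) (contDiffAt_of_base_mem hΩ (X.φ_smooth m hm (J + k) (by omega)) hw)
        contDiffAt_fst
    have := hσ α
    simp only [stepPart, div_eq_mul_inv]
    fun_prop

theorem contDiffAt_defect (hΩ : IsOpen Ω) (hrp : r ≤ p) (i : Fin M ⊕ (Fin M × Fin (p + 1)))
    {w : Jet p} (hw : w.base ∈ Ω) (h : Fin M → ℝ) :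
    ContDiffAt ℝ ∞ (fun q : (Jet p × (Fin M → ℝ)) × ℝ => X.defect i q.1.1 q.1.2 q.2)
      ((w, h), 0) := by
  unfold defect
  refine ContDiffAt.sub (ContDiffAt.sum fun m hm => ?_)
    (ContDiffAt.sum fun m hm => ContDiffAt.sum fun k hk => ?_)
  · have hm' : m ≤ r := by have := Finset.mem_range.1 hm; omega
    have hc := contDiffAt_of_base_mem hΩ (X.contDiffOn_component m hm' i) hw
    have h1 : ContDiffAt ℝ ∞ (fun q : (Jet p × (Fin M → ℝ)) × ℝ => X.component m i
        (flow q.1.1 (q.2 * q.1.2 (stepIndex i)))) ((w, h), 0) := by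
      refine ContDiffAt.comp (g := X.component m i) ((w, h), (0 : ℝ)) ?_ (by fun_prop)
      simpa [flow_zero] using hc
    have h2 : ContDiffAt ℝ ∞ (fun q : (Jet p × (Fin M → ℝ)) × ℝ => X.component m i q.1.1)
        ((w, h), 0) :=
      ContDiffAt.comp (g := X.component m i) ((w, h), (0 : ℝ)) hc (by fun_prop)
    fun_prop
  · have hm' : m ≤ r := by have := Finset.mem_range.1 hm; omega
    have h1 : ContDiffAt ℝ ∞ (fun q : (Jet p × (Fin M → ℝ)) × ℝ =>
        X.stepPart m k i q.1.1 q.1.2) ((w, h), 0) :=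
      ContDiffAt.comp (g := fun q : Jet p × (Fin M → ℝ) => X.stepPart m k i q.1 q.2)
        ((w, h), (0 : ℝ)) (X.contDiffAt_stepPart hΩ hrp hm' (Finset.mem_Icc.1 hk).2 i hw h)
        contDiffAt_fst
    fun_prop

theorem contDiffAt_field (hΩ : IsOpen Ω) {m : ℕ} (hm : m ≤ r) {z : Grid p M}
    (hz : z ∈ gridDomain p M Ω) : ContDiffAt ℝ ∞ (X.field m) z := by
  have hnode : ∀ α, ContDiffAt ℝ ∞ (fun z : Grid p M => z.1 α) z := fun α => by fun_prop
  unfold field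
  refine ContDiffAt.prodMk (contDiffAt_pi.2 fun α => ContDiffAt.prodMk ?_
    (contDiffAt_pi.2 fun J => ?_)) (contDiffAt_pi.2 fun α => ?_)
  · exact ContDiffAt.comp (g := X.ξJet m) z
      (contDiffAt_of_base_mem hΩ (X.contDiffOn_ξJet hm) (hz α)) (hnode α)
  · exact ContDiffAt.comp (g := X.φ m J) z
      (contDiffAt_of_base_mem hΩ (X.φ_smooth m hm J (by omega)) (hz α)) (hnode α)
  · exact ContDiffAt.comp (g := fun q : Jet p × (Fin M → ℝ) => X.σ m α q.1 q.2) z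
      ((X.σ_smooth m hm α).contDiffAt
        (((isOpen_base_mem hΩ).preimage continuous_fst).mem_nhds (hz _)))
      ((hnode _).prodMk contDiffAt_snd)

theorem contDiffAt_approxField (hΩ : IsOpen Ω) {z : Grid p M}
    (hz : z ∈ gridDomain p M Ω) (ε : ℝ) :
    ContDiffAt ℝ ∞ (fun q : Grid p M × ℝ => X.approxField q.1 q.2) (z, ε) := by
  unfold approxField
  refine ContDiffAt.sum fun m hm => ?_
  have hm' : m ≤ r := by have := Finset.mem_range.1 hm; omega
  have : ContDiffAt ℝ ∞ (fun q : Grid p M × ℝ => X.field m q.1) (z, ε) :=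
    ContDiffAt.comp (g := X.field m) (z, ε) (X.contDiffAt_field hΩ hm' hz) contDiffAt_fst
  exact (contDiffAt_snd.pow m).smul this

/-- This holds on every grid, solution or not. Since `r ≤ p`, all indices `J + k` stay within `2p`,
so no coefficient is cut off. If the next node is the exact step, the right-hand side is `defect`.
-/
theorem taylorSystemDeriv_approxField (hr : 1 ≤ r) (hrp : r ≤ p)
    (i : Fin M ⊕ (Fin M × Fin (p + 1))) (z : Grid p M) (ε : ℝ) :
    taylorSystemDeriv r i z ε (X.approxField z ε) =
      ∑ m ∈ Finset.range (r + 1), ε ^ m * (X.component m i (z.1 (stepIndex i).succ) -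
        X.component m i (z.1 (stepIndex i).castSucc)) -
      ∑ m ∈ Finset.range (r + 1), ∑ k ∈ Finset.Icc 1 r,
        ε ^ (m + k) * X.stepPart m k i (z.1 (stepIndex i).castSucc) z.2 := by
  have hx : ∀ α, ((X.approxField z ε).1 α).1 =
      ∑ m ∈ Finset.range (r + 1), ε ^ m * X.ξJet m (z.1 α) := by
    intro α
    simp [approxField, Prod.fst_sum, field, ξJet]
  have hh : ∀ α, (X.approxField z ε).2 α =
      ∑ m ∈ Finset.range (r + 1), ε ^ m * X.σ m α (z.1 α.castSucc) z.2 := by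
    intro α
    simp [approxField, Prod.snd_sum, field]
  have hu : ∀ α, ∀ j ≤ 2 * p, ((X.approxField z ε).1 α).u j =
      ∑ m ∈ Finset.range (r + 1), ε ^ m * X.φ m j (z.1 α) := by
    intro α j hj
    rw [Jet.u_of_lt (by omega)]
    simp [approxField, Prod.fst_sum, Prod.snd_sum, field]
  rcases i with α | ⟨α, J⟩
  · simp only [taylorSystemDeriv, hx, hh, component, stepIndex, Sum.elim_inl, id, stepPart]
    simp only [mul_sub, Finset.sum_sub_distrib, Finset.mul_sum, mul_ite, mul_zero]
    congr 1
    refine Finset.sum_congr rfl fun m _ => ?_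
    rw [Finset.sum_ite_eq' (Finset.Icc 1 r) 1, if_pos (Finset.mem_Icc.2 ⟨le_rfl, hr⟩)]
    ring
  · have hJ := J.2
    simp only [taylorSystemDeriv, hh, component, stepIndex, Sum.elim_inr, stepPart]
    rw [hu _ J (by omega), hu _ J (by omega)]
    simp only [mul_sub, Finset.sum_sub_distrib]
    congr 1
    rw [Finset.sum_comm]
    refine Finset.sum_congr rfl fun k hk => ?_
    have hk' := Finset.mem_Icc.1 hk
    rw [hu _ (J + k) (by omega)]
    obtain ⟨l, rfl⟩ : ∃ l, k = l + 1 := ⟨k - 1, by omega⟩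
    rw [Nat.add_sub_cancel, Nat.factorial_succ]
    simp only [Finset.mul_sum, Finset.sum_mul, ← Finset.sum_add_distrib]
    refine Finset.sum_congr rfl fun m _ => ?_
    have h1 : (l : ℝ) + 1 ≠ 0 := by positivity
    push_cast
    field_simp
    ring

/-- Taylor's formula along the flow makes the defect a polynomial in `ε` modulo `o(ε^r)`. The zeroth
Taylor term cancels against the value at `w`, so there is no condition for `n = 0`. -/
theorem isLittleO_defect_iff (hΩ : IsOpen Ω) (i : Fin M ⊕ (Fin M × Fin (p + 1))) {w : Jet p}
    (hw : w.base ∈ Ω) (h : Fin M → ℝ) :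
    (X.defect i w h =o[𝓝 0] fun ε => ε ^ r) ↔ ∀ n, 1 ≤ n → n ≤ r →
      ∑ k ∈ Finset.Icc 1 n, (h (stepIndex i) ^ k / (k.factorial : ℝ) *
        (totalDeriv^[k] (X.component (n - k) i)) w - X.stepPart (n - k) k i w h) = 0 := by
  set η := h (stepIndex i) with hη
  set c : ℕ → ℕ → ℝ := fun m k => η ^ k / (k.factorial : ℝ) *
        (totalDeriv^[k] (X.component m i)) w - X.stepPart m k i w h with hc
  have hT : (fun ε : ℝ => ∑ m ∈ Finset.range (r + 1), ε ^ m *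
      (X.component m i (flow w (ε * η)) - ∑ l ∈ Finset.range (r + 1),
        (ε * η) ^ l / (l.factorial : ℝ) * (totalDeriv^[l] (X.component m i)) w))
      =o[𝓝 0] fun ε => ε ^ r := by
    refine IsLittleO.fun_sum fun m hm => ?_
    have hm' : m ≤ r := by have := Finset.mem_range.1 hm; omega
    have h0 : Tendsto (fun ε : ℝ => ε * η) (𝓝 0) (𝓝 0) :=
      (by fun_prop : Continuous fun ε : ℝ => ε * η).tendsto' _ _ (by simp)
    have h1 := (isLittleO_taylor_flow hΩ (X.contDiffOn_component m hm' i) hw r).comp_tendsto h0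
    have h2 : ((fun t : ℝ => t ^ r) ∘ fun ε => ε * η) =O[𝓝 0] fun ε => ε ^ r := by
      refine IsBigO.of_bound (|η| ^ r) (.of_forall fun ε => ?_)
      simp [mul_pow, mul_comm]
    have h3 : (fun ε : ℝ => ε ^ m) =O[𝓝 0] fun _ => (1 : ℝ) :=
      (by fun_prop : Continuous fun ε : ℝ => ε ^ m).continuousAt.tendsto.isBigO_one ℝ
    simpa [Function.comp_def] using h3.mul_isLittleO (h1.trans_isBigO h2)
  have hS := hT.add (sum_pow_mul_isLittleO r c)
  have hEq : ∀ ε : ℝ, X.defect i w h ε - ∑ n ∈ Finset.range (r + 1),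
      ε ^ n • ∑ k ∈ Finset.Icc 1 n, c (n - k) k =
      (∑ m ∈ Finset.range (r + 1), ε ^ m *
      (X.component m i (flow w (ε * η)) - ∑ l ∈ Finset.range (r + 1),
        (ε * η) ^ l / (l.factorial : ℝ) * (totalDeriv^[l] (X.component m i)) w)) +
      (∑ m ∈ Finset.range (r + 1), ∑ k ∈ Finset.Icc 1 r, ε ^ (m + k) * c m k -
        ∑ n ∈ Finset.range (r + 1), ε ^ n • ∑ k ∈ Finset.Icc 1 n, c (n - k) k) := by
    intro ε
    rw [← add_sub_assoc]
    congr 1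
    rw [defect, ← Finset.sum_sub_distrib, ← Finset.sum_add_distrib]
    refine Finset.sum_congr rfl fun m _ => ?_
    have hsplit : ∑ l ∈ Finset.range (r + 1),
        (ε * η) ^ l / (l.factorial : ℝ) * (totalDeriv^[l] (X.component m i)) w =
        X.component m i w + ∑ l ∈ Finset.Icc 1 r,
        (ε * η) ^ l / (l.factorial : ℝ) * (totalDeriv^[l] (X.component m i)) w := by
      rw [Finset.range_eq_Ico, Finset.sum_eq_sum_Ico_succ_bot (by omega)]
      simp only [pow_zero, Nat.factorial_zero, Nat.cast_one, div_one, one_mul,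
        Function.iterate_zero, id]
      rfl
    have hsum : ∑ k ∈ Finset.Icc 1 r, ε ^ (m + k) * c m k =
        ε ^ m * ∑ l ∈ Finset.Icc 1 r,
        (ε * η) ^ l / (l.factorial : ℝ) * (totalDeriv^[l] (X.component m i)) w -
        ∑ k ∈ Finset.Icc 1 r, ε ^ (m + k) * X.stepPart m k i w h := by
      rw [Finset.mul_sum, ← Finset.sum_sub_distrib]
      refine Finset.sum_congr rfl fun k _ => ?_
      rw [hc, mul_pow, pow_add]
      ring
    rw [hsplit, hsum]
    ring
  have hS' := hS.congr_left fun ε => (hEq ε).symm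
  constructor
  · intro hd n hn hnr
    have := coeff_eq_zero_of_isLittleO (c := fun n => ∑ k ∈ Finset.Icc 1 n, c (n - k) k)
      ((hd.sub hS').congr_left fun ε => sub_sub_cancel _ _)
    exact this n hnr
  · intro hn
    refine hS'.congr_left fun ε => ?_
    rw [Finset.sum_eq_zero, sub_zero]
    intro n hnr
    rcases Nat.eq_zero_or_pos n with rfl | hn0
    · simp
    · rw [hn n hn0 (by have := Finset.mem_range.1 hnr; omega), smul_zero]

end Coefficients

/-! ### Passing between `o(t ^ n)` and `O(t ^ (n + 1))` -/

section Comparison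

variable {E F : Type*} [NormedAddCommGroup E] [NormedSpace ℝ E] [NormedAddCommGroup F]
  [NormedSpace ℝ F]

theorem isBigO_comp_sub {T : Type*} {l : Filter T} {G : E → F} {q : E} (hG : ContDiffAt ℝ ∞ G q)
    {c d : T → E} (hc : Tendsto c l (𝓝 q)) (hd : Tendsto d l (𝓝 q)) :
    (fun t => G (c t) - G (d t)) =O[l] fun t => c t - d t :=
  (hG.hasStrictFDerivAt (by simp)).isBigO_sub.comp_tendsto (hc.prodMk_nhds hd)

/-- For smooth functions the two conditions are equivalent; the big-O form is the one that
Gronwall's inequality propagates. -/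
theorem isBigO_pow_succ_of_isLittleO {g : ℝ → F} {n : ℕ} (hg : ContDiffAt ℝ ∞ g 0)
    (h : g =o[𝓝 0] fun t => t ^ n) : g =O[𝓝 0] fun t => t ^ (n + 1) := by
  have hsm : ContDiffAt ℝ ∞ (fun s : ℝ × ℝ => g s.2) (0, 0) :=
    ContDiffAt.comp (g := g) ((0 : ℝ), (0 : ℝ)) hg contDiffAt_snd
  have := isBigO_of_eventually_isLittleO (contDiffAt_infty.1 hsm (n + 1)) (.of_forall fun _ => h)
  exact this.comp_tendsto
    ((Continuous.prodMk_right (0 : ℝ)).tendsto' 0 ((0 : ℝ), (0 : ℝ)) rfl)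

omit [NormedSpace ℝ F] in
theorem isLittleO_pow_of_isBigO_pow_succ {g : ℝ → F} {n : ℕ} (h : g =O[𝓝 0] fun t : ℝ => t ^ (n + 1)) :
    g =o[𝓝 0] fun t : ℝ => t ^ n :=
  h.trans_isLittleO (isLittleO_pow_pow n.lt_succ_self)

end Comparison

/-! ### Orbits of an approximate group -/

section Group

variable {Z : Type*} [NormedAddCommGroup Z] [NormedSpace ℝ Z] {r : ℕ} {S : Set Z}
  {U : Set (Z × ℝ × ℝ)} {f : Z → ℝ → ℝ → Z}

/-- The derivative `∂ₐ f(z, ε, a)`. -/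
noncomputable def velocity (f : Z → ℝ → ℝ → Z) (q : Z × ℝ × ℝ) : Z :=
  fderiv ℝ (fun q : Z × ℝ × ℝ => f q.1 q.2.1 q.2.2) q (0, 0, 1)

namespace IsApproxGroup

variable (hf : IsApproxGroup r S U f)

include hf

theorem contDiffAt {q : Z × ℝ × ℝ} (hq : q ∈ U) :
    ContDiffAt ℝ ∞ (fun q : Z × ℝ × ℝ => f q.1 q.2.1 q.2.2) q :=
  hf.smooth.contDiffAt (hf.isOpen_domain.mem_nhds hq)

theorem contDiffAt_velocity {q : Z × ℝ × ℝ} (hq : q ∈ U) : ContDiffAt ℝ ∞ (velocity f) q :=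
  ((hf.contDiffAt hq).fderiv_right (m := ∞) (by simp)).clm_apply contDiffAt_const

theorem hasDerivAt {z : Z} {ε a : ℝ} (hq : (z, ε, a) ∈ U) :
    HasDerivAt (fun a => f z ε a) (velocity f (z, ε, a)) a := by
  have h1 : HasDerivAt (fun a : ℝ => (z, ε, a)) ((0 : Z), (0 : ℝ), (1 : ℝ)) a :=
    (hasDerivAt_const _ _).prodMk ((hasDerivAt_const _ _).prodMk (hasDerivAt_id _))
  exact HasFDerivAt.comp_hasDerivAt (f := fun a : ℝ => (z, ε, a)) a
    ((hf.contDiffAt hq).differentiableAt (by simp)).hasFDerivAt h1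

/-- Uniformity in the base point is the purpose: the estimate may then be used along families
`z(ε)`. -/
theorem isBigO_initial (hS : IsOpen S) {z : Z} (hz : z ∈ S) :
    (fun s : Z × ℝ => f s.1 s.2 0 - s.1) =O[𝓝 (z, 0)] fun s => s.2 ^ (r + 1) := by
  have hsm : ContDiffAt ℝ ∞ (fun s : Z × ℝ => f s.1 s.2 0 - s.1) (z, 0) := by
    refine ContDiffAt.sub ?_ contDiffAt_fst
    exact ContDiffAt.comp (g := fun q : Z × ℝ × ℝ => f q.1 q.2.1 q.2.2)
      (f := fun s : Z × ℝ => (s.1, s.2, (0 : ℝ))) (z, (0 : ℝ)) (hf.contDiffAt (hf.zero_mem z hz))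
      (by fun_prop)
  refine isBigO_of_eventually_isLittleO (contDiffAt_infty.1 hsm (r + 1)) ?_
  filter_upwards [hS.mem_nhds hz] with s hs using hf.initial s hs

theorem isBigO_velocity_zero (hS : IsOpen S) {A : Z → ℝ → Z}
    (hA : ∀ z ∈ S, ContDiffAt ℝ ∞ (fun q : Z × ℝ => A q.1 q.2) (z, 0))
    (hX : ∀ z ∈ S, (fun ε : ℝ => deriv (fun a => f z ε a) 0 - A z ε) =o[𝓝 0] fun ε => ε ^ r)
    {z : Z} (hz : z ∈ S) :
    (fun s : Z × ℝ => velocity f (s.1, s.2, 0) - A s.1 s.2) =O[𝓝 (z, 0)]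
      fun s => s.2 ^ (r + 1) := by
  have hsm : ContDiffAt ℝ ∞ (fun s : Z × ℝ => velocity f (s.1, s.2, 0) - A s.1 s.2) (z, 0) := by
    refine ContDiffAt.sub ?_ (hA z hz)
    exact ContDiffAt.comp (g := velocity f)
      (f := fun s : Z × ℝ => (s.1, s.2, (0 : ℝ))) (z, (0 : ℝ))
      (hf.contDiffAt_velocity (hf.zero_mem z hz)) (by fun_prop)
  refine isBigO_of_eventually_isLittleO (contDiffAt_infty.1 hsm (r + 1)) ?_
  filter_upwards [hS.mem_nhds hz] with s hs
  refine (hX s hs).congr' ?_ .rfl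
  have hc : Tendsto (fun ε : ℝ => (s, ε, (0 : ℝ))) (𝓝 0) (𝓝 (s, 0, 0)) :=
    (by fun_prop : Continuous fun ε : ℝ => (s, ε, (0 : ℝ))).tendsto' _ _ rfl
  filter_upwards [hc.eventually (hf.isOpen_domain.mem_nhds (hf.zero_mem s hs))] with ε hε
  rw [(hf.hasDerivAt hε).deriv]

/-- The group law, differentiated in `b` at `b = 0`; smoothness in `(b, ε)` permits differentiating
the little-o. -/
theorem isLittleO_velocity_sub {z : Z} {a : ℝ} (ha : (z, (0 : ℝ), a) ∈ U) :
    (fun ε : ℝ => velocity f (f z ε a, ε, 0) - velocity f (z, ε, a)) =o[𝓝 0] fun ε => ε ^ r := by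
  have h0 : (f z 0 a, (0 : ℝ), (0 : ℝ)) ∈ U := hf.zero_mem _ (hf.mapsTo _ _ _ ha).2
  have hcU : Tendsto (fun ε : ℝ => (z, ε, a)) (𝓝 0) (𝓝 (z, 0, a)) :=
    (by fun_prop : Continuous fun ε : ℝ => (z, ε, a)).tendsto' _ _ rfl
  have hfc : ContDiffAt ℝ ∞ (fun ε : ℝ => f z ε a) 0 :=
    ContDiffAt.comp (g := fun q : Z × ℝ × ℝ => f q.1 q.2.1 q.2.2)
      (f := fun ε : ℝ => (z, ε, a)) (0 : ℝ) (hf.contDiffAt ha) (by fun_prop)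
  have hcW : Tendsto (fun ε : ℝ => (f z ε a, ε, (0 : ℝ))) (𝓝 0) (𝓝 (f z 0 a, 0, 0)) :=
    hfc.continuousAt.tendsto.prodMk_nhds (tendsto_id.prodMk_nhds tendsto_const_nhds)
  have hd1 : ContDiffAt ℝ ∞ (fun s : ℝ × ℝ => f (f z s.2 a) s.2 s.1) (0, 0) := by
    refine ContDiffAt.comp (g := fun q : Z × ℝ × ℝ => f q.1 q.2.1 q.2.2)
      (f := fun s : ℝ × ℝ => (f z s.2 a, s.2, s.1)) ((0 : ℝ), (0 : ℝ)) (hf.contDiffAt h0) ?_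
    exact (ContDiffAt.comp (g := fun ε : ℝ => f z ε a) ((0 : ℝ), (0 : ℝ)) hfc
      contDiffAt_snd).prodMk (contDiffAt_snd.prodMk contDiffAt_fst)
  have hd2 : ContDiffAt ℝ ∞ (fun s : ℝ × ℝ => f z s.2 (a + s.1)) (0, 0) := by
    refine ContDiffAt.comp (g := fun q : Z × ℝ × ℝ => f q.1 q.2.1 q.2.2)
      (f := fun s : ℝ × ℝ => (z, s.2, a + s.1)) ((0 : ℝ), (0 : ℝ)) ?_ (by fun_prop)
    simpa using hf.contDiffAt ha
  have hsm := hd1.sub hd2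
  have hpt : ∀ᶠ b : ℝ in 𝓝 0, (fun ε : ℝ => ((fun s : ℝ × ℝ => f (f z s.2 a) s.2 s.1) -
      fun s : ℝ × ℝ => f z s.2 (a + s.1)) (b, ε)) =o[𝓝 0] fun ε => ε ^ r := by
    have t1 : Tendsto (fun b : ℝ => (f z 0 a, (0 : ℝ), b)) (𝓝 0) (𝓝 (f z 0 a, 0, 0)) :=
      (by fun_prop : Continuous fun b : ℝ => (f z 0 a, (0 : ℝ), b)).tendsto' _ _ rfl
    have t2 : Tendsto (fun b : ℝ => (z, (0 : ℝ), a + b)) (𝓝 0) (𝓝 (z, 0, a)) :=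
      (by fun_prop : Continuous fun b : ℝ => (z, (0 : ℝ), a + b)).tendsto' _ _ (by simp)
    filter_upwards [t1.eventually (hf.isOpen_domain.mem_nhds h0),
      t2.eventually (hf.isOpen_domain.mem_nhds ha)] with b hb1 hb2
    exact hf.group_law z a b ha hb1 hb2
  refine (isLittleO_fderiv_fst (contDiffAt_infty.1 hsm (r + 2)) hpt 1).congr' ?_ .rfl
  have hmk : Tendsto (fun ε : ℝ => ((0 : ℝ), ε)) (𝓝 0) (𝓝 (0, 0)) :=
    (Continuous.prodMk_right (0 : ℝ)).tendsto' _ _ rfl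
  filter_upwards [hcU.eventually (hf.isOpen_domain.mem_nhds ha),
    hcW.eventually (hf.isOpen_domain.mem_nhds h0),
    hmk.eventually ((contDiffAt_infty.1 hsm 1).eventually (by simp))] with ε hU hW hε
  have h1 : HasDerivAt (fun b : ℝ => (b, ε)) ((1 : ℝ), (0 : ℝ)) 0 :=
    (hasDerivAt_id _).prodMk (hasDerivAt_const _ _)
  have h2 := HasFDerivAt.comp_hasDerivAt (f := fun b : ℝ => (b, ε)) (0 : ℝ)
    (hε.differentiableAt (by simp)).hasFDerivAt h1
  have h3 : HasDerivAt (fun b => f z ε (a + b)) (velocity f (z, ε, a)) 0 := by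
    have : HasDerivAt (fun b => f z ε b) (velocity f (z, ε, a)) (a + 0) := by
      rw [add_zero]
      exact hf.hasDerivAt hU
    exact this.comp_const_add a 0
  exact h2.unique ((hf.hasDerivAt hW).sub h3)

/-- Up to `O(ε ^ (r + 1))`, the orbits of the approximate group are integral curves of its
approximate infinitesimal operator. -/
theorem isBigO_velocity_sub (hS : IsOpen S) {A : Z → ℝ → Z}
    (hA : ∀ z ∈ S, ContDiffAt ℝ ∞ (fun q : Z × ℝ => A q.1 q.2) (z, 0))
    (hX : ∀ z ∈ S, (fun ε : ℝ => deriv (fun a => f z ε a) 0 - A z ε) =o[𝓝 0] fun ε => ε ^ r)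
    {z : Z} {a : ℝ} (ha : (z, (0 : ℝ), a) ∈ U) :
    (fun s : (Z × ℝ) × ℝ => velocity f (s.1.1, s.2, s.1.2) - A (f s.1.1 s.2 s.1.2) s.2)
      =O[𝓝 ((z, a), 0)] fun s => s.2 ^ (r + 1) := by
  have hmap : ContDiffAt ℝ ∞ (fun s : (Z × ℝ) × ℝ => (s.1.1, s.2, s.1.2)) ((z, a), 0) := by
    fun_prop
  have hv : ContDiffAt ℝ ∞ (fun s : (Z × ℝ) × ℝ => velocity f (s.1.1, s.2, s.1.2)) ((z, a), 0) :=
    ContDiffAt.comp (g := velocity f) ((z, a), (0 : ℝ)) (hf.contDiffAt_velocity ha) hmap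
  have hfs : ContDiffAt ℝ ∞ (fun s : (Z × ℝ) × ℝ => f s.1.1 s.2 s.1.2) ((z, a), 0) :=
    ContDiffAt.comp (g := fun q : Z × ℝ × ℝ => f q.1 q.2.1 q.2.2) ((z, a), (0 : ℝ))
      (hf.contDiffAt ha) hmap
  have hAs : ContDiffAt ℝ ∞ (fun s : (Z × ℝ) × ℝ => A (f s.1.1 s.2 s.1.2) s.2) ((z, a), 0) :=
    ContDiffAt.comp (g := fun q : Z × ℝ => A q.1 q.2)
      (f := fun s : (Z × ℝ) × ℝ => (f s.1.1 s.2 s.1.2, s.2)) ((z, a), (0 : ℝ))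
      (hA _ (hf.mapsTo _ _ _ ha).2) (hfs.prodMk contDiffAt_snd)
  refine isBigO_of_eventually_isLittleO (contDiffAt_infty.1 (hv.sub hAs) (r + 1)) ?_
  have hc : Tendsto (fun s : Z × ℝ => (s.1, (0 : ℝ), s.2)) (𝓝 (z, a)) (𝓝 (z, 0, a)) :=
    (by fun_prop : Continuous fun s : Z × ℝ => (s.1, (0 : ℝ), s.2)).tendsto' _ _ rfl
  filter_upwards [hc.eventually (hf.isOpen_domain.mem_nhds ha)] with s hs
  have hfc : ContinuousAt (fun ε : ℝ => f s.1 ε s.2) 0 :=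
    (ContDiffAt.comp (g := fun q : Z × ℝ × ℝ => f q.1 q.2.1 q.2.2)
      (f := fun ε : ℝ => (s.1, ε, s.2)) (0 : ℝ) (hf.contDiffAt hs) (by fun_prop)).continuousAt
  -- The base point `f(s.1, ε, s.2)` moves with `ε`, so the locally uniform form of the generator
  -- condition is needed.
  have h1 := ((hf.isBigO_velocity_zero hS hA hX (hf.mapsTo _ _ _ hs).2).comp_tendsto
    (hfc.tendsto.prodMk_nhds tendsto_id))
  have h2 := isLittleO_pow_of_isBigO_pow_succ (n := r) h1
  refine (h2.sub (hf.isLittleO_velocity_sub hs)).congr_left fun ε => ?_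
  simp only [Function.comp_apply, id]
  abel

end IsApproxGroup

end Group

/-! ### Substituting approximations into smooth functions -/

section Compare

variable {Z V : Type*} [NormedAddCommGroup Z] [NormedSpace ℝ Z] [NormedAddCommGroup V]
  [NormedSpace ℝ V] {T : Type*} {l : Filter T} {ε : T → ℝ} {y₁ y₂ v₁ v₂ : T → Z} {y v : Z}

omit [NormedSpace ℝ Z] in
theorem tendsto_of_isBigO_sub (hε : Tendsto ε l (𝓝 0)) (hy₂ : Tendsto y₂ l (𝓝 y)) {n : ℕ}
    (hy : (fun t => y₁ t - y₂ t) =O[l] fun t => ε t ^ (n + 1)) : Tendsto y₁ l (𝓝 y) := by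
  have h0 : Tendsto (fun t => ε t ^ (n + 1)) l (𝓝 0) := by simpa using hε.pow (n + 1)
  simpa using (hy.trans_tendsto h0).add hy₂

theorem isBigO_sub_of_contDiff {G : Z → ℝ → V}
    (hG : ContDiff ℝ ∞ fun q : Z × ℝ => G q.1 q.2) (hε : Tendsto ε l (𝓝 0))
    (hy₂ : Tendsto y₂ l (𝓝 y)) {n : ℕ}
    (hy : (fun t => y₁ t - y₂ t) =O[l] fun t => ε t ^ (n + 1)) :
    (fun t => G (y₁ t) (ε t) - G (y₂ t) (ε t)) =O[l] fun t => ε t ^ (n + 1) := by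
  have hy₁ := tendsto_of_isBigO_sub hε hy₂ hy
  have h := isBigO_comp_sub (c := fun t => (y₁ t, ε t)) (d := fun t => (y₂ t, ε t))
    (hG.contDiffAt (x := (y, (0 : ℝ)))) (hy₁.prodMk_nhds hε) (hy₂.prodMk_nhds hε)
  refine h.trans (isBigO_prod_left.2 ⟨hy, ?_⟩)
  simpa using isBigO_zero _ _

theorem isBigO_sub_of_contDiff₂ {G : Z → ℝ → Z → V}
    (hG : ContDiff ℝ ∞ fun q : Z × ℝ × Z => G q.1 q.2.1 q.2.2)
    (hε : Tendsto ε l (𝓝 0)) (hy₂ : Tendsto y₂ l (𝓝 y)) (hv₂ : Tendsto v₂ l (𝓝 v)) {n : ℕ}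
    (hy : (fun t => y₁ t - y₂ t) =O[l] fun t => ε t ^ (n + 1))
    (hv : (fun t => v₁ t - v₂ t) =O[l] fun t => ε t ^ (n + 1)) :
    (fun t => G (y₁ t) (ε t) (v₁ t) - G (y₂ t) (ε t) (v₂ t))
      =O[l] fun t => ε t ^ (n + 1) := by
  have hy₁ := tendsto_of_isBigO_sub hε hy₂ hy
  have hv₁ := tendsto_of_isBigO_sub hε hv₂ hv
  have h := isBigO_comp_sub (c := fun t => (y₁ t, ε t, v₁ t)) (d := fun t => (y₂ t, ε t, v₂ t))
    (hG.contDiffAt (x := (y, (0 : ℝ), v)))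
    (hy₁.prodMk_nhds (hε.prodMk_nhds hv₁)) (hy₂.prodMk_nhds (hε.prodMk_nhds hv₂))
  refine h.trans (isBigO_prod_left.2 ⟨hy, isBigO_prod_left.2 ⟨?_, hv⟩⟩)
  simpa using isBigO_zero _ _

end Compare

/-! ### Invariance and tangency -/

section Tangency

variable {Z ι : Type*} [NormedAddCommGroup Z] [NormedSpace ℝ Z] {r : ℕ} {S : Set Z}
  {U : Set (Z × ℝ × ℝ)} {f : Z → ℝ → ℝ → Z} {F : ι → Z → ℝ → ℝ} {F' : ι → Z → ℝ → Z → ℝ}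
  {A : Z → ℝ → Z}

namespace IsApproxGroup

/-- A group preserving the system is tangent to its solutions. -/
theorem isLittleO_of_isApproxInvariant (hf : IsApproxGroup r S U f)
    (hS : IsOpen S) (hA : ∀ z ∈ S, ContDiffAt ℝ ∞ (fun q : Z × ℝ => A q.1 q.2) (z, 0))
    (hX : ∀ z ∈ S, (fun ε : ℝ => deriv (fun a => f z ε a) 0 - A z ε) =o[𝓝 0] fun ε => ε ^ r)
    (hFs : ∀ i, ContDiff ℝ ∞ fun q : Z × ℝ => F i q.1 q.2)
    (hF's : ∀ i, ContDiff ℝ ∞ fun q : Z × ℝ × Z => F' i q.1 q.2.1 q.2.2)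
    (hFd : ∀ (i : ι) (c : ℝ → Z) (c' : Z) (a : ℝ), HasDerivAt c c' a → ∀ ε,
      HasDerivAt (fun s => F i (c s) ε) (F' i (c a) ε c') a)
    (hinv : IsApproxInvariant r S U f F) {z : ℝ → Z} (hzsm : ContDiff ℝ ∞ z) (hz0 : z 0 ∈ S)
    (hzF : ∀ i, (fun ε => F i (z ε) ε) =o[𝓝 0] fun ε => ε ^ r) (i : ι) :
    (fun ε => F' i (z ε) ε (A (z ε) ε)) =o[𝓝 0] fun ε => ε ^ r := by
  have h0 := hf.zero_mem _ hz0
  have hκ : Continuous fun q : ℝ × ℝ => (z q.2, q.2, q.1) := by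
    have := hzsm.continuous
    fun_prop
  have hfz : ContDiffAt ℝ ∞ (fun q : ℝ × ℝ => f (z q.2) q.2 q.1) (0, 0) := by
    refine ContDiffAt.comp (g := fun q : Z × ℝ × ℝ => f q.1 q.2.1 q.2.2)
      (f := fun q : ℝ × ℝ => (z q.2, q.2, q.1)) ((0 : ℝ), (0 : ℝ)) (hf.contDiffAt h0) ?_
    exact (hzsm.comp contDiff_snd).contDiffAt.prodMk (contDiffAt_snd.prodMk contDiffAt_fst)
  have hH : ContDiffAt ℝ ∞ (fun q : ℝ × ℝ =>
      F i (f (z q.2) q.2 q.1) q.2) (0, 0) :=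
    ContDiffAt.comp (g := fun q : Z × ℝ => F i q.1 q.2)
      (f := fun q : ℝ × ℝ => (f (z q.2) q.2 q.1, q.2)) ((0 : ℝ), (0 : ℝ))
      (hFs i).contDiffAt (hfz.prodMk contDiffAt_snd)
  have hpt : ∀ᶠ a : ℝ in 𝓝 0, (fun ε : ℝ => F i (f (z ε) ε a) ε)
      =o[𝓝 0] fun ε => ε ^ r := by
    have t : Tendsto (fun a : ℝ => (z 0, (0 : ℝ), a)) (𝓝 0) (𝓝 (z 0, 0, 0)) :=
      (by fun_prop : Continuous fun a : ℝ => (z 0, (0 : ℝ), a)).tendsto' _ _ rfl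
    filter_upwards [t.eventually (hf.isOpen_domain.mem_nhds h0)] with a ha
    exact hinv z hzsm.contDiffAt hz0 hzF a ha i
  have h1 := isLittleO_fderiv_fst (contDiffAt_infty.1 hH (r + 2)) hpt 1
  have hmk : Tendsto (fun ε : ℝ => ((0 : ℝ), ε)) (𝓝 0) (𝓝 (0, 0)) :=
    (Continuous.prodMk_right (0 : ℝ)).tendsto' _ _ rfl
  have h2 : (fun ε : ℝ => F' i (f (z ε) ε 0) ε (velocity f (z ε, ε, 0)))
      =o[𝓝 0] fun ε => ε ^ r := by
    refine h1.congr' ?_ .rfl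
    filter_upwards [(hκ.continuousAt.tendsto.comp hmk).eventually (hf.isOpen_domain.mem_nhds h0),
      hmk.eventually ((contDiffAt_infty.1 hH 1).eventually (by simp))] with ε hU hε
    have d1 : HasDerivAt (fun b : ℝ => (b, ε)) ((1 : ℝ), (0 : ℝ)) 0 :=
      (hasDerivAt_id _).prodMk (hasDerivAt_const _ _)
    have d2 := HasFDerivAt.comp_hasDerivAt (f := fun b : ℝ => (b, ε)) (0 : ℝ)
      (hε.differentiableAt (by simp)).hasFDerivAt d1
    exact d2.unique (hFd i _ _ _ (hf.hasDerivAt hU) ε)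
  have hz1 : Tendsto (fun ε => (z ε, ε)) (𝓝 0) (𝓝 (z 0, 0)) :=
    (hzsm.continuous.tendsto 0).prodMk_nhds tendsto_id
  have hO1 := (hf.isBigO_initial hS hz0).comp_tendsto hz1
  have hO2 := (hf.isBigO_velocity_zero hS (hA) hX
    hz0).comp_tendsto hz1
  have hA : Tendsto (fun ε => A (z ε) ε) (𝓝 0) (𝓝 (A (z 0) 0)) :=
    (hA _ hz0).continuousAt.tendsto.comp hz1
  -- At `a = 0` the orbit and its velocity are `z` and `A` up to `O(ε^(r+1))`, and the smooth `F'`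
  -- transmits this error.
  have h3 := isBigO_sub_of_contDiff₂ (hF's i) tendsto_id (hzsm.continuous.tendsto 0) hA
    hO1 hO2
  refine (h2.sub (isLittleO_pow_of_isBigO_pow_succ h3)).congr_left fun ε => ?_
  simp only [id, sub_sub_cancel]

/-- A group whose operator is tangent to the solutions of the system preserves the system. -/
theorem isApproxInvariant_of_isBigO [Fintype ι] (hf : IsApproxGroup r S U f)
    (hS : IsOpen S) (hA : ∀ z ∈ S, ContDiffAt ℝ ∞ (fun q : Z × ℝ => A q.1 q.2) (z, 0))
    (hX : ∀ z ∈ S, (fun ε : ℝ => deriv (fun a => f z ε a) 0 - A z ε) =o[𝓝 0] fun ε => ε ^ r)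
    (hFs : ∀ i, ContDiff ℝ ∞ fun q : Z × ℝ => F i q.1 q.2)
    (hF's : ∀ i, ContDiff ℝ ∞ fun q : Z × ℝ × Z => F' i q.1 q.2.1 q.2.2)
    (hFd : ∀ (i : ι) (c : ℝ → Z) (c' : Z) (a : ℝ), HasDerivAt c c' a → ∀ ε,
      HasDerivAt (fun s => F i (c s) ε) (F' i (c a) ε c') a)
    (htan : ∀ z ∈ S, (∀ i, F i z 0 = 0) → ∀ i, (fun q : Z × ℝ => F' i q.1 q.2 (A q.1 q.2))
      =O[𝓝 (z, 0)] fun q => ‖fun i => F i q.1 q.2‖ + |q.2| ^ (r + 1)) :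
    IsApproxInvariant r S U f F := by
  intro z hz hz0 hF a ha
  set e : ℝ × ℝ → ι → ℝ :=
    fun s i => F i (f (z s.2) s.2 s.1) s.2 with he
  have hκ : ∀ a : ℝ, Tendsto (fun s : ℝ × ℝ => (z s.2, s.2, s.1)) (𝓝 (a, 0)) (𝓝 (z 0, 0, a)) :=
    fun a => (hz.continuousAt.tendsto.comp (continuous_snd.tendsto (a, (0 : ℝ)))).prodMk_nhds
      ((continuous_snd.tendsto _).prodMk_nhds (continuous_fst.tendsto _))
  have hfz : ∀ a : ℝ, (z 0, (0 : ℝ), a) ∈ U →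
      Tendsto (fun s : ℝ × ℝ => f (z s.2) s.2 s.1) (𝓝 (a, 0)) (𝓝 (f (z 0) 0 a)) := fun a ha =>
    (hf.contDiffAt ha).continuousAt.tendsto.comp (hκ a)
  have hec : ∀ a : ℝ, (z 0, (0 : ℝ), a) ∈ U → ContinuousAt e (a, 0) := by
    intro a ha
    refine continuousAt_pi.2 fun i => ?_
    exact ((hFs i).continuous.tendsto (f (z 0) 0 a, 0)).comp
      ((hfz a ha).prodMk_nhds (continuous_snd.tendsto (a, (0 : ℝ))))
  -- Local propagation near `a`. The condition `e(a, 0) = 0` puts the limit point of the orbit on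
  -- the zero set of the system at `ε = 0`, where tangency is assumed.
  have hstep : ∀ a : ℝ, (z 0, (0 : ℝ), a) ∈ U → e (a, 0) = 0 → ∃ A ∈ 𝓝 a, ∀ b ∈ A, ∀ c ∈ A,
      (fun t => e (b, t)) =O[𝓝 0] (fun t : ℝ => t ^ (r + 1)) →
      (fun t => e (c, t)) =O[𝓝 0] fun t : ℝ => t ^ (r + 1) := by
    intro a ha h0
    refine exists_nhds_isBigO_propagates (e' := fun s i =>
      F' i (f (z s.2) s.2 s.1) s.2 (velocity f (z s.2, s.2, s.1))) ?_ ?_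
    · filter_upwards [(hκ a).eventually (hf.isOpen_domain.mem_nhds ha)] with s hs
      exact hasDerivAt_pi.2 fun i => hFd i _ _ _ (hf.hasDerivAt hs) s.2
    · refine isBigO_pi.2 fun i => ?_
      have hmemS := (hf.mapsTo _ _ _ ha).2
      have hfε : Tendsto (fun s : ℝ × ℝ => (f (z s.2) s.2 s.1, s.2)) (𝓝 (a, 0))
          (𝓝 (f (z 0) 0 a, 0)) := (hfz a ha).prodMk_nhds (continuous_snd.tendsto (a, (0 : ℝ)))
      have hκ' : Tendsto (fun s : ℝ × ℝ => ((z s.2, s.1), s.2)) (𝓝 (a, 0)) (𝓝 ((z 0, a), 0)) :=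
        ((hz.continuousAt.tendsto.comp (continuous_snd.tendsto (a, (0 : ℝ)))).prodMk_nhds
          (continuous_fst.tendsto _)).prodMk_nhds (continuous_snd.tendsto _)
      have hO := (hf.isBigO_velocity_sub hS (hA) hX
        ha).comp_tendsto hκ'
      have hA : Tendsto (fun s : ℝ × ℝ => A (f (z s.2) s.2 s.1) s.2) (𝓝 (a, 0))
          (𝓝 (A (f (z 0) 0 a) 0)) :=
        (hA _ hmemS).continuousAt.tendsto.comp hfε
      have h1 := isBigO_sub_of_contDiff₂ (hF's i) (continuous_snd.tendsto (a, (0 : ℝ)))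
        (hfz a ha) hA ((isBigO_zero _ _).congr_left fun s => (sub_self _).symm) hO
      have h3 := (htan _ hmemS (fun i => congrFun h0 i) i).comp_tendsto hfε
      have h4 : (fun s : ℝ × ℝ => s.2 ^ (r + 1)) =O[𝓝 (a, 0)]
          fun s => ‖e s‖ + |s.2| ^ (r + 1) := by
        refine IsBigO.of_bound 1 (.of_forall fun s => ?_)
        rw [one_mul, Real.norm_of_nonneg (by positivity : 0 ≤ ‖e s‖ + |s.2| ^ (r + 1)), norm_pow,
          Real.norm_eq_abs]
        exact le_add_of_nonneg_left (norm_nonneg _)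
      refine ((h1.trans h4).add h3).congr_left fun s => ?_
      simp only [Function.comp_apply]
      ring
  set I : Set ℝ := {a | (z 0, (0 : ℝ), a) ∈ U} with hI
  have hIopen : IsOpen I := hf.isOpen_domain.preimage
    (by fun_prop : Continuous fun a : ℝ => (z 0, (0 : ℝ), a))
  set G : Set ℝ := {a | a ∈ I ∧ (fun t => e (a, t)) =O[𝓝 0] fun t : ℝ => t ^ (r + 1)} with hG
  have hGzero : ∀ b ∈ G, e (b, 0) = 0 := by
    rintro b ⟨_, hb⟩
    have := hb.eq_zero_imp.self_of_nhds
    exact this (by simp)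
  -- The slice `I` is an interval, so it is enough that `G` is open, meets `I` and is relatively
  -- closed in it.
  have hsub : I ⊆ G := by
    refine (hf.slice _ hz0).isPreconnected.subset_of_closure_inter_subset ?_ ?_ ?_
    · refine isOpen_iff_mem_nhds.2 fun b hb => ?_
      obtain ⟨A, hA, hprop⟩ := hstep b hb.1 (hGzero b hb)
      filter_upwards [hA, hIopen.mem_nhds hb.1] with c hcA hcI
      exact ⟨hcI, hprop b (mem_of_mem_nhds hA) c hcA hb.2⟩
    · refine ⟨0, hf.zero_mem _ hz0, hf.zero_mem _ hz0, isBigO_pi.2 fun i => ?_⟩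
      have hzε : Tendsto (fun ε => (z ε, ε)) (𝓝 0) (𝓝 (z 0, 0)) :=
        hz.continuousAt.tendsto.prodMk_nhds tendsto_id
      have hO1 := (hf.isBigO_initial hS hz0).comp_tendsto hzε
      have h1 := isBigO_sub_of_contDiff (hFs i) tendsto_id hz.continuousAt.tendsto hO1
      have h3 : (fun ε => F i (z ε) ε) =O[𝓝 0] fun ε : ℝ => ε ^ (r + 1) :=
        isBigO_pow_succ_of_isLittleO (ContDiffAt.comp
          (g := fun q : Z × ℝ => F i q.1 q.2)
          (f := fun ε : ℝ => (z ε, ε)) (0 : ℝ) (hFs i).contDiffAt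
          (hz.prodMk contDiffAt_id)) (hF i)
      refine (h1.add h3).congr_left fun ε => ?_
      simp only [he, id]
      ring
    · rintro b ⟨hbG, hbI⟩
      -- A limit point of `G` inherits `e = 0` at `ε = 0` by continuity. Local propagation therefore
      -- applies around `b` and brings the estimate there from a nearby point of `G`.
      have h0 : e (b, 0) = 0 := by
        have hc : ContinuousAt (fun c : ℝ => e (c, 0)) b :=
          ContinuousAt.comp (f := fun c : ℝ => (c, (0 : ℝ))) (hec b hbI) (by fun_prop)
        have hmem := hc.continuousWithinAt (s := G) |>.mem_closure (t := {0}) hbG hGzero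
        simpa using hmem
      obtain ⟨A, hA, hprop⟩ := hstep b hbI h0
      obtain ⟨c, hcA, hcG⟩ := mem_closure_iff_nhds.1 hbG A hA
      exact ⟨hbI, hprop c hcA b (mem_of_mem_nhds hA) hcG.2⟩
  exact fun i => isLittleO_pow_of_isBigO_pow_succ (isBigO_pi.1 (hsub ha).2 i)

end IsApproxGroup

end Tangency

/-! ### The system as the deviation of a grid from the exact step -/

section Remainder

variable {p r M : ℕ}

/-- The part of the Taylor sum of `u⁽ᴶ⁾` beyond the order `r`. -/
noncomputable def flowTail (r J : ℕ) (w : Jet p) (t : ℝ) : ℝ :=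
  ∑ k ∈ Finset.Ico (r + 1) (2 * p + 1), t ^ k / (k.factorial : ℝ) * w.u (J + k)

theorem flow_u_eq (hr : r ≤ 2 * p) (w : Jet p) (t : ℝ) (J : ℕ) :
    (flow w t).u J = w.u J + ∑ k ∈ Finset.Icc 1 r, t ^ k / (k.factorial : ℝ) * w.u (J + k) +
      flowTail r J w t := by
  rw [flow_u, flowTail, ← Finset.sum_range_add_sum_Ico _ (show r + 1 ≤ 2 * p + 1 by omega),
    Finset.range_eq_Ico, Finset.sum_eq_sum_Ico_succ_bot (by omega)]
  simp only [pow_zero, Nat.factorial_zero, Nat.cast_one, div_one, one_mul, add_zero]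
  rfl

theorem isBigO_flowTail {T : Type*} {l : Filter T} {W : T → Jet p} {w : Jet p} {ε η : T → ℝ}
    {h : ℝ} (hW : Tendsto W l (𝓝 w)) (hε : Tendsto ε l (𝓝 0)) (hη : Tendsto η l (𝓝 h))
    (r J : ℕ) : (fun t => flowTail r J (W t) (ε t * η t)) =O[l] fun t => ε t ^ (r + 1) := by
  refine IsBigO.fun_sum fun k hk => ?_
  have h1 : (fun t => ε t ^ k) =O[l] fun t => ε t ^ (r + 1) := by
    refine IsBigO.of_bound 1 ?_
    filter_upwards [hε.eventually (Metric.ball_mem_nhds (0 : ℝ) one_pos)] with t ht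
    have ht' : |ε t| < 1 := by simpa using ht
    simpa using pow_le_pow_of_le_one (abs_nonneg _) ht'.le (Finset.mem_Ico.1 hk).1
  have h2 : (fun t => η t ^ k / (k.factorial : ℝ) * (W t).u (J + k)) =O[l] fun _ => (1 : ℝ) :=
    (((hη.pow k).div_const _).mul
      (((Jet.contDiff_u (n := 0) (J + k)).continuous.tendsto w).comp hW)).isBigO_one ℝ
  refine (h1.mul h2).congr (fun t => ?_) fun t => mul_one _
  rw [mul_pow]
  ring

theorem taylorSystem_inl_eq (α : Fin M) (z : Grid p M) (ε : ℝ) :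
    taylorSystem p r M (Sum.inl α) z ε =
      (z.1 α.succ).1 - (flow (z.1 α.castSucc) (ε * z.2 α)).1 := by
  simp only [taylorSystem, flow_fst]
  ring

theorem taylorSystem_inr_eq (hr : r ≤ 2 * p) (α : Fin M) (J : Fin (p + 1)) (z : Grid p M) (ε : ℝ) :
    taylorSystem p r M (Sum.inr (α, J)) z ε =
      (z.1 α.succ).u J - (flow (z.1 α.castSucc) (ε * z.2 α)).u J +
        flowTail r J (z.1 α.castSucc) (ε * z.2 α) := by
  rw [flow_u_eq hr]
  simp only [taylorSystem, mul_pow, mul_div_right_comm]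
  ring

/-- For exact steps only the Taylor tail beyond order `r` survives in the equations. -/
theorem isLittleO_taylorSystem_flow (hr : r ≤ 2 * p) {z : ℝ → Grid p M} (hz : ContinuousAt z 0)
    (h : ∀ α ε, (z ε).1 (Fin.succ α) = flow ((z ε).1 α.castSucc) (ε * (z ε).2 α))
    (i : Fin M ⊕ (Fin M × Fin (p + 1))) :
    (fun ε => taylorSystem p r M i (z ε) ε) =o[𝓝 0] fun ε => ε ^ r := by
  rcases i with α | ⟨α, J⟩
  · refine (isLittleO_zero _ _).congr_left fun ε => ?_
    rw [taylorSystem_inl_eq, h, sub_self]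
  · have h1 : Tendsto (fun ε => (z ε).1 α.castSucc) (𝓝 0) (𝓝 ((z 0).1 α.castSucc)) :=
      (by fun_prop : Continuous fun y : Grid p M => y.1 α.castSucc).continuousAt.tendsto.comp
        hz.tendsto
    have h2 : Tendsto (fun ε => (z ε).2 α) (𝓝 0) (𝓝 ((z 0).2 α)) :=
      (by fun_prop : Continuous fun y : Grid p M => y.2 α).continuousAt.tendsto.comp hz.tendsto
    refine (isLittleO_pow_of_isBigO_pow_succ (isBigO_flowTail h1 tendsto_id h2 r J)).congr_left fun ε => ?_
    rw [taylorSystem_inr_eq hr, h, sub_self, zero_add, id]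

end Remainder

namespace Coefficients

variable {p r M : ℕ} {Ω : Set (ℝ × ℝ)} (X : Coefficients p r M Ω)

/-- A function of order at most `p` takes almost the same value at a node and at the exact step from
the preceding node if the system is almost satisfied. -/
theorem isBigO_sub_flow (hrp : r ≤ p) (hΩ : IsOpen Ω) {ψ : Jet p → ℝ}
    (hψ : ContDiffOn ℝ ∞ ψ {w | w.base ∈ Ω}) (hord : HasOrderLE Ω p ψ) {z : Grid p M}
    (hz : z ∈ gridDomain p M Ω) (hF : ∀ i, taylorSystem p r M i z 0 = 0) (α : Fin M) :
    (fun q : Grid p M × ℝ => ψ (q.1.1 α.succ) - ψ (flow (q.1.1 α.castSucc) (q.2 * q.1.2 α)))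
      =O[𝓝 (z, 0)] fun q => ‖fun i => taylorSystem p r M i q.1 q.2‖ + |q.2| ^ (r + 1) := by
  set W : Grid p M × ℝ → Jet p := fun q => flow (q.1.1 α.castSucc) (q.2 * q.1.2 α) with hW
  -- The system says nothing about `u⁽ᴶ⁾` with `J > p`, so the exact step `W` need not be close to
  -- the next node. The hybrid `V` takes `x, u, …, u⁽ᵖ⁾` from `W` and the rest from the next node:
  -- it is close to that node, and `ψ` cannot distinguish it from `W`.
  set V : Grid p M × ℝ → Jet p := fun q => ((W q).1, fun J : Fin (2 * p + 1) =>
    if (J : ℕ) ≤ p then (W q).u J else (q.1.1 α.succ).u J) with hV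
  have hWc : Continuous W := (by fun_prop : ContDiff ℝ 0 W).continuous
  have hVu : ∀ q j, j ≤ p → (V q).u j = (W q).u j := by
    intro q j hj
    rw [Jet.u_of_lt (show j < 2 * p + 1 by omega)]
    simp [hV, hj]
  have hVbase : ∀ q, (V q).base = (W q).base := fun q =>
    Prod.ext rfl (hVu q 0 (Nat.zero_le p))
  have hVc : Continuous V := by
    refine Continuous.prodMk (by fun_prop) (continuous_pi fun J => ?_)
    split_ifs
    · exact ((Jet.contDiff_u (n := 0) _).continuous).comp hWc
    · exact ((Jet.contDiff_u (n := 0) _).continuous).comp (by fun_prop)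
  have hW0 : W (z, 0) = z.1 α.castSucc := by simp [hW, flow_zero]
  have hV0 : V (z, 0) = z.1 α.succ := by
    refine Jet.ext_u ?_ fun j hj => ?_
    · have := hF (Sum.inl α)
      rw [taylorSystem_inl_eq, sub_eq_zero] at this
      exact this.symm
    · rw [Jet.u_of_lt (show j < 2 * p + 1 by omega)]
      simp only [hV]
      split_ifs with hjp
      · have := hF (Sum.inr (α, ⟨j, by omega⟩))
        rw [taylorSystem_inr_eq (by omega), zero_mul] at this
        rw [hW0]
        have ht : flowTail r j (z.1 α.castSucc) 0 = 0 := by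
          refine Finset.sum_eq_zero fun k hk => ?_
          have := (Finset.mem_Ico.1 hk).1
          rw [zero_pow (by omega), zero_div, zero_mul]
        simp only [ht, flow_zero, add_zero] at this
        linarith
      · rfl
  have hnode : Continuous fun q : Grid p M × ℝ => q.1.1 α.succ := by fun_prop
  have h1 := isBigO_comp_sub (contDiffAt_of_base_mem hΩ hψ (hz α.succ))
    (hnode.tendsto (z, 0)) (by simpa only [hV0] using hVc.tendsto (z, 0))
  have hWΩ : ∀ᶠ q in 𝓝 (z, (0 : ℝ)), (W q).base ∈ Ω :=
    hWc.continuousAt.eventually ((isOpen_base_mem hΩ).mem_nhds (by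
      show (W (z, 0)).base ∈ Ω
      rw [hW0]
      exact hz _))
  have h2 : (fun q : Grid p M × ℝ => ψ (q.1.1 α.succ) - ψ (V q)) =ᶠ[𝓝 (z, 0)]
      fun q => ψ (q.1.1 α.succ) - ψ (W q) := by
    filter_upwards [hWΩ] with q hq
    rw [hord (V q) (W q) (by rwa [hVbase]) hq rfl (hVu q)]
  refine (h1.congr' h2 .rfl).trans ?_
  have hFle : ∀ i (q : Grid p M × ℝ), ‖taylorSystem p r M i q.1 q.2‖ ≤
      ‖‖fun i => taylorSystem p r M i q.1 q.2‖ + |q.2| ^ (r + 1)‖ := by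
    intro i q
    have := norm_le_pi_norm (fun i => taylorSystem p r M i q.1 q.2) i
    rw [Real.norm_of_nonneg (by positivity : 0 ≤ ‖fun i => taylorSystem p r M i q.1 q.2‖ +
      |q.2| ^ (r + 1))]
    exact this.trans (le_add_of_nonneg_right (by positivity))
  have hεle : (fun q : Grid p M × ℝ => q.2 ^ (r + 1)) =O[𝓝 (z, 0)]
      fun q => ‖fun i => taylorSystem p r M i q.1 q.2‖ + |q.2| ^ (r + 1) := by
    refine IsBigO.of_bound 1 (.of_forall fun q => ?_)
    rw [one_mul, Real.norm_of_nonneg (by positivity : 0 ≤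
      ‖fun i => taylorSystem p r M i q.1 q.2‖ + |q.2| ^ (r + 1)), norm_pow, Real.norm_eq_abs]
    exact le_add_of_nonneg_left (norm_nonneg _)
  refine isBigO_prod_left.2 ⟨?_, isBigO_pi.2 fun J => ?_⟩
  · refine IsBigO.of_bound 1 (.of_forall fun q => ?_)
    have := hFle (Sum.inl α) q
    rw [taylorSystem_inl_eq] at this
    rw [one_mul]
    exact this
  · by_cases hJ : (J : ℕ) ≤ p
    · have htail : (fun q : Grid p M × ℝ => flowTail r J (q.1.1 α.castSucc) (q.2 * q.1.2 α))
          =O[𝓝 (z, 0)] fun q => q.2 ^ (r + 1) :=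
        isBigO_flowTail ((by fun_prop : Continuous fun q : Grid p M × ℝ =>
          q.1.1 α.castSucc).tendsto (z, 0)) (continuous_snd.tendsto (z, (0 : ℝ)))
          ((by fun_prop : Continuous fun q : Grid p M × ℝ => q.1.2 α).tendsto (z, 0)) r J
      have hFO : (fun q : Grid p M × ℝ =>
          taylorSystem p r M (Sum.inr (α, ⟨J, by omega⟩)) q.1 q.2) =O[𝓝 (z, 0)]
          fun q => ‖fun i => taylorSystem p r M i q.1 q.2‖ + |q.2| ^ (r + 1) :=
        IsBigO.of_bound 1 (.of_forall fun q => by rw [one_mul]; exact hFle _ q)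
      refine (hFO.sub (htail.trans hεle)).congr_left fun q => ?_
      rw [taylorSystem_inr_eq (by omega)]
      simp only [hV, Pi.sub_apply, if_pos hJ]
      rw [← Jet.u_of_lt J.2]
      ring
    · refine (isBigO_zero _ _).congr_left fun q => ?_
      simp only [hV, Pi.sub_apply, if_neg hJ]
      rw [← Jet.u_of_lt J.2, sub_self]

/-- The operator is tangent to the solutions of the system, up to `O(ε ^ (r + 1))`. -/
theorem isBigO_taylorSystemDeriv_approxField (hr : 1 ≤ r) (hrp : r ≤ p) (hΩ : IsOpen Ω)
    (i : Fin M ⊕ (Fin M × Fin (p + 1)))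
    (hdef : ∀ w : Jet p, w.base ∈ Ω → ∀ h, X.defect i w h =o[𝓝 0] fun ε => ε ^ r)
    {z : Grid p M} (hz : z ∈ gridDomain p M Ω) (hF : ∀ i, taylorSystem p r M i z 0 = 0) :
    (fun q : Grid p M × ℝ => taylorSystemDeriv r i q.1 q.2 (X.approxField q.1 q.2))
      =O[𝓝 (z, 0)] fun q => ‖fun i => taylorSystem p r M i q.1 q.2‖ + |q.2| ^ (r + 1) := by
  have hw := hz (stepIndex i).castSucc
  have h1 : (fun s : (Jet p × (Fin M → ℝ)) × ℝ => X.defect i s.1.1 s.1.2 s.2)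
      =O[𝓝 ((z.1 (stepIndex i).castSucc, z.2), 0)] fun s => s.2 ^ (r + 1) := by
    refine isBigO_of_eventually_isLittleO
      (contDiffAt_infty.1 (X.contDiffAt_defect hΩ hrp i hw z.2) (r + 1)) ?_
    filter_upwards [((isOpen_base_mem hΩ).preimage continuous_fst).mem_nhds hw] with s hs
    exact hdef s.1 hs s.2
  have hc : Continuous fun q : Grid p M × ℝ =>
      ((q.1.1 (stepIndex i).castSucc, q.1.2), q.2) := by fun_prop
  have h2 := h1.comp_tendsto (hc.tendsto (z, 0))
  have hεle : (fun q : Grid p M × ℝ => q.2 ^ (r + 1)) =O[𝓝 (z, 0)]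
      fun q => ‖fun i => taylorSystem p r M i q.1 q.2‖ + |q.2| ^ (r + 1) := by
    refine IsBigO.of_bound 1 (.of_forall fun q => ?_)
    rw [one_mul, Real.norm_of_nonneg (by positivity : 0 ≤
      ‖fun i => taylorSystem p r M i q.1 q.2‖ + |q.2| ^ (r + 1)), norm_pow, Real.norm_eq_abs]
    exact le_add_of_nonneg_left (norm_nonneg _)
  have h3 : (fun q : Grid p M × ℝ => ∑ m ∈ Finset.range (r + 1), q.2 ^ m *
      (X.component m i (q.1.1 (stepIndex i).succ) - X.component m i
        (flow (q.1.1 (stepIndex i).castSucc) (q.2 * q.1.2 (stepIndex i))))) =O[𝓝 (z, 0)]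
      fun q => ‖fun i => taylorSystem p r M i q.1 q.2‖ + |q.2| ^ (r + 1) := by
    refine IsBigO.fun_sum fun m hm => ?_
    have hm' : m ≤ r := by have := Finset.mem_range.1 hm; omega
    have hpow : (fun q : Grid p M × ℝ => q.2 ^ m) =O[𝓝 (z, 0)] fun _ => (1 : ℝ) :=
      ((by fun_prop : Continuous fun q : Grid p M × ℝ => q.2 ^ m).tendsto (z, 0)).isBigO_one ℝ
    simpa using hpow.mul (isBigO_sub_flow hrp hΩ (X.contDiffOn_component m hm' i)
      (X.hasOrderLE_component m hm' i) hz hF (stepIndex i))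
  -- The derivative along the operator is the defect plus the error made by replacing each next node
  -- with the exact step.
  refine (h3.add (h2.trans hεle)).congr_left fun q => ?_
  rw [X.taylorSystemDeriv_approxField hr hrp]
  simp only [Function.comp_apply, defect]
  rw [← add_sub_assoc, ← Finset.sum_add_distrib]
  congr 1
  refine Finset.sum_congr rfl fun m _ => ?_
  ring

variable {U : Set (Grid p M × ℝ × ℝ)} {f : Grid p M → ℝ → ℝ → Grid p M}

/-- Any `w` and `h` occur in an exact solution: place all nodes on one orbit of the flow. Tangency
along this solution is the claim. -/
theorem isLittleO_defect_of_isApproxInvariant (hr : 1 ≤ r) (hrp : r ≤ p) (hΩ : IsOpen Ω)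
    (hf : IsApproxGroup r (gridDomain p M Ω) U f)
    (hX : HasApproxGenerator r (gridDomain p M Ω) f X.field)
    (hinv : IsApproxInvariant r (gridDomain p M Ω) U f (taylorSystem p r M))
    (i : Fin M ⊕ (Fin M × Fin (p + 1))) {w : Jet p} (hw : w.base ∈ Ω) (h : Fin M → ℝ) :
    X.defect i w h =o[𝓝 0] fun ε => ε ^ r := by
  have hS := isOpen_gridDomain (p := p) (M := M) hΩ
  set α := stepIndex i with hα
  -- Partial sums of the step sizes. Subtracting `s α` below keeps node `α` at `w` for every `ε`.
  let s : ℕ → ℝ := fun n => ∑ j ∈ Finset.range n, if hj : j < M then h ⟨j, hj⟩ else 0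
  have hs : ∀ γ : Fin M, s (γ + 1) = s γ + h γ := fun γ => by
    simp only [s, Finset.sum_range_succ, dif_pos γ.2]
  let z : ℝ → Grid p M := fun ε => (fun β => flow w (ε * (s β - s α)), h)
  have hzsm : ContDiff ℝ ∞ z := by
    refine ContDiff.prodMk (contDiff_pi.2 fun β => ?_) contDiff_const
    fun_prop
  have hz0 : z 0 ∈ gridDomain p M Ω := by
    intro β
    simp only [z, zero_mul, flow_zero]
    exact hw
  have hzF : ∀ i, (fun ε => taylorSystem p r M i (z ε) ε) =o[𝓝 0] fun ε => ε ^ r := by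
    refine isLittleO_taylorSystem_flow (by omega) hzsm.continuous.continuousAt fun γ ε => ?_
    simp only [z, flow_flow, Fin.val_succ, Fin.val_castSucc, hs]
    congr 1
    ring
  refine (hf.isLittleO_of_isApproxInvariant hS (fun y hy => X.contDiffAt_approxField hΩ hy 0) hX
    contDiff_taylorSystem contDiff_taylorSystemDeriv
    (fun i _ _ _ => hasDerivAt_taylorSystem i) hinv hzsm hz0 hzF i).congr_left fun ε => ?_
  rw [X.taylorSystemDeriv_approxField hr hrp, defect]
  have e1 : (z ε).1 (stepIndex i).castSucc = w := by
    simp [z, hα, flow_zero]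
  have e2 : (z ε).1 (stepIndex i).succ = flow w (ε * h (stepIndex i)) := by
    simp only [z, Fin.val_succ, hs, ← hα]
    congr 1
    ring
  rw [e1, e2]

theorem isApproxInvariant_of_isLittleO_defect (hr : 1 ≤ r) (hrp : r ≤ p) (hΩ : IsOpen Ω)
    (hf : IsApproxGroup r (gridDomain p M Ω) U f)
    (hX : HasApproxGenerator r (gridDomain p M Ω) f X.field)
    (hdef : ∀ i, ∀ w : Jet p, w.base ∈ Ω → ∀ h, X.defect i w h =o[𝓝 0] fun ε => ε ^ r) :
    IsApproxInvariant r (gridDomain p M Ω) U f (taylorSystem p r M) := by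
  exact hf.isApproxInvariant_of_isBigO (isOpen_gridDomain hΩ)
    (fun y hy => X.contDiffAt_approxField hΩ hy 0) hX contDiff_taylorSystem
    contDiff_taylorSystemDeriv (fun i _ _ _ => hasDerivAt_taylorSystem i)
    fun z hz hF i => X.isBigO_taylorSystemDeriv_approxField hr hrp hΩ i (hdef i) hz hF

end Coefficients

end FDSymmetry

theorem theorem4 (p r M : ℕ) (hr : 1 ≤ r) (hrp : r ≤ p) (hM : 1 ≤ M)
    (Ω : Set (ℝ × ℝ)) (hΩ : IsOpen Ω)
    (X : FDSymmetry.Coefficients p r M Ω)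
    (U : Set (FDSymmetry.Grid p M × ℝ × ℝ))
    (f : FDSymmetry.Grid p M → ℝ → ℝ → FDSymmetry.Grid p M)
    (hf : FDSymmetry.IsApproxGroup r (FDSymmetry.gridDomain p M Ω) U f)
    (hX : FDSymmetry.HasApproxGenerator r (FDSymmetry.gridDomain p M Ω) f X.field) :
    FDSymmetry.IsApproxInvariant r (FDSymmetry.gridDomain p M Ω) U f
        (FDSymmetry.taylorSystem p r M) ↔
      (∀ k < r, ∀ α : Fin M, ∀ w : FDSymmetry.Jet p, w.base ∈ Ω → ∀ h : Fin M → ℝ,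
        X.σ k α w h = ∑ l ∈ Finset.Icc 1 (k + 1),
          h α ^ l / (l.factorial : ℝ) * (FDSymmetry.totalDeriv^[l] (X.ξJet (k + 1 - l))) w) ∧
      (∀ k < r, ∀ J : ℕ, J + k < p + r → ∀ w : FDSymmetry.Jet p, w.base ∈ Ω →
        X.φ k (J + 1) w =
          FDSymmetry.totalDeriv (X.φ k J) w
            - w.u (J + 1) * FDSymmetry.totalDeriv (X.ξJet k) w) := by
  rw [← X.forall_sum_eq_zero_iff hrp hM hΩ]
  constructor
  · intro hinv i w hw h
    exact (X.isLittleO_defect_iff hΩ i hw h).1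
      (X.isLittleO_defect_of_isApproxInvariant hr hrp hΩ hf hX hinv i hw h)
  · intro H
    exact X.isApproxInvariant_of_isLittleO_defect hr hrp hΩ hf hX fun i w hw h =>
      (X.isLittleO_defect_iff hΩ i hw h).2 (H i w hw h)
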